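/- In the randomized $\mathsf{CONGEST}$ model, an $n$-node network is a simple graph $G$ on $n$ nodes, each of which has a unique identifier, a bit string of a common length $\beta$ with $2^\beta\ge n$ (such as $\beta=\Theta(\log n)$). Initially every node knows $n$, its own identifier and those of its neighbours, and it has access to random coins (private or shared). In each synchronous round every node performs unlimited local computation and sends to each of its neighbours a message, possibly different for different neighbours, of at most $C\log n$ bits, where $C>0$ is a constant. An algorithm decides in $R$ rounds whether the network contains an induced $k$-cycle if, for every network of the class under consideration and every assignment of identifiers, with probability at least $2/3$ the following holds after $R$ rounds: at least one node outputs $1$ if $G$ contains an induced $k$-cycle, and all nodes output $0$ otherwise. Theorem. Let $k=8\ell+m$ with integers $\ell\ge 1$ and $0\le m\le 7$. Deciding whether a graph contains an induced $k$-cycle requires $\Omega\left(n^{2-1/\ell}/\log n\right)$ rounds in the $\mathsf{CONGEST}$ model, even on networks of diameter $3$. That is, for every $C>0$ there are $\delta>0$ and $n_0$ such that, for all $n\ge n_0$, every randomized algorithm with messages of at most $C\log n$ bits which decides in $R$ rounds whether an $n$-node network of diameter exactly $3$ contains an induced $k$-cycle satisfies $R\ge \delta\, n^{2-1/\ell}/\log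 n$. -/

import Mathlib

open MeasureTheory

universe u v

namespace Congest

/-- Node identifiers: bit strings of length `β`. -/
abbrev NodeId (β : ℕ) : Type := Fin β → Bool

/-- Messages: bit strings of length at most `B` (the empty string may stand for silence). -/
abbrev Message (B : ℕ) : Type := {w : List Bool // w.length ≤ B}

/-- A randomized message-passing algorithm for `n`-node networks with `β`-bit identifiers and at most
`B` bits per edge, direction and round. Local computation is unlimited, so the four maps are
arbitrary. Since the algorithm is chosen for given `n`, `β`, `B`, all nodes know these numbers (and
the graph to be detected).

`Ω` is the sample space of all the coin flips. Every node may look at the whole sample point, so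
shared randomness is allowed. Private coins are the special case in which `Ω` is a product with one
factor for each identifier and a node with identifier `i` looks only at the factor `i`;
deterministic algorithms are the case of a one-point `Ω`. -/
structure Algorithm (Ω : Type u) (n β B : ℕ) where
  /-- The local states of a node. -/
  State : Type v
  /-- The initial state: computed from the own identifier, the set of the identifiers of the
  neighbours, and the coins. -/
  init : NodeId β → Set (NodeId β) → Ω → State
  /-- `send s i` is the message that a node in state `s` sends to its neighbour with identifier `i`;
  different neighbours may get different messages. -/
  send : State → NodeId β → Message B
  /-- The new state at the end of a round, computed from the old one and from the received messages,
  each of them labelled with the identifier of its sender. -/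
  receive : State → Set (NodeId β × Message B) → State
  /-- The output of a node in a given state: `true` is `1` (Yes), `false` is `0` (No). -/
  output : State → Bool

namespace Algorithm

variable {Ω : Type u} {n β B : ℕ}

/-- The state of node `p` after `t` synchronous rounds, in the network `G` with identifiers `ids`,
with coins `ω`. -/
def state (alg : Algorithm.{u, v} Ω n β B) (G : SimpleGraph (Fin n)) (ids : Fin n ↪ NodeId β)
    (ω : Ω) : ℕ → Fin n → alg.State
  | 0, p => alg.init (ids p) {i | ∃ q, G.Adj p q ∧ i = ids q} ω
  | t + 1, p => alg.receive (state alg G ids ω t p)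
      {x | ∃ q, G.Adj p q ∧ x = (ids q, alg.send (state alg G ids ω t q) (ids p))}

/-- The network answers Yes after `R` rounds: at least one node outputs `1`. Otherwise all nodes
output `0`. -/
def AnswersYes (alg : Algorithm.{u, v} Ω n β B) (R : ℕ) (G : SimpleGraph (Fin n))
    (ids : Fin n ↪ NodeId β) (ω : Ω) : Prop :=
  ∃ p, alg.output (alg.state G ids ω R p) = true

/-- The coins for which the answer after `R` rounds to the question whether `G` satisfies `P` is
correct. -/
def correctSet (alg : Algorithm.{u, v} Ω n β B) (R : ℕ) (P : SimpleGraph (Fin n) → Prop)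
    (G : SimpleGraph (Fin n)) (ids : Fin n ↪ NodeId β) : Set Ω :=
  {ω | alg.AnswersYes R G ids ω ↔ P G}

/-- With coins distributed according to `μ`, the algorithm decides the graph predicate `P` in `R`
rounds on the `n`-node networks of the class `𝒢`: for every network in `𝒢` and every assignment of
unique identifiers, the answer is correct with probability at least `2 / 3`. -/
def Decides [MeasurableSpace Ω] (alg : Algorithm.{u, v} Ω n β B) (μ : Measure Ω) (R : ℕ)
    (𝒢 : Set (SimpleGraph (Fin n))) (P : SimpleGraph (Fin n) → Prop) : Prop :=
  ∀ G ∈ 𝒢, ∀ ids : Fin n ↪ NodeId β,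
    MeasurableSet (alg.correctSet R P G ids) ∧ 2 / 3 ≤ μ.real (alg.correctSet R P G ids)

end Algorithm

/-- `G` contains an induced `k`-cycle (used for `k ≥ 3`). -/
def HasInducedCycle {V : Type*} (k : ℕ) (G : SimpleGraph V) : Prop :=
  (SimpleGraph.cycleGraph k).IsIndContained G

end Congest

/-! The bound is a reduction from set disjointness. The pairs in a universe of about `s ^ (2 * ℓ)`
elements are encoded in a graph with about `s ^ ℓ` vertices, split between Alice and Bob so that
only `O(ℓ * s)` edges cross; the graph has an induced `k`-cycle exactly if the inputs meet. An
`R`-round algorithm yields a protocol with `O(R * s * log n)` bits, while disjointness needs `Ω(s ^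
(2 * ℓ))`. Hence `R` is at least of order `s ^ (2 * ℓ - 1) / log n`, and `s ≈ n ^ (1 / ℓ)` gives the
exponent.

The communication bound (`exp_le_card_transcripts`) is a corruption argument. By `level_one`, a
family that is not exponentially sparse among the subsets of `T` has almost unbiased coordinates for
most `i ∈ T`. So a rectangle with much mass on disjoint pairs has a comparable mass on pairs meeting
in one point (`corruption`). Few rectangles therefore cannot accept most disjoint pairs and reject
most intersecting ones.

The transfer to networks is `cut_and_paste`: equal traffic on the cut lets Alice's half of one run
be joined to Bob's half of another.

In the graphs, every element is a pair `(i, j)` of code words. A cycle runs through the observers of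
`i` and `j` on both sides, which must be nonadjacent; a pair of observers is nonadjacent exactly if
it lies in that side's input. The vertices are covered by cliques, of which an induced cycle takes
at most two vertices each. The capacities add up to `k`, so all are exhausted, and this rigidity
forces both sides to use the same `(i, j)`. For `ℓ = 1` the observers are matched directly across
the cut; for `ℓ ≥ 2` their words are compared symbol by symbol along levels with `s` vertices each.
Two hubs with pendant vertices fix the diameter at three. -/

namespace SetDisjointness

/-! ### Biases of the coordinates in a large family of sets -/

variable {ι : Type*} [DecidableEq ι]

/-- The number of members of the family `A` which are contained in `T`. -/
noncomputable def below (A : Finset (Finset ι)) (T : Finset ι) : ℝ :=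
  ((A.filter (· ⊆ T)).card : ℝ)

theorem below_nonneg (A : Finset (Finset ι)) (T : Finset ι) : 0 ≤ below A T := by
  unfold below; positivity

theorem below_mono (A : Finset (Finset ι)) {S T : Finset ι} (h : S ⊆ T) : below A S ≤ below A T := by
  unfold below
  exact_mod_cast Finset.card_le_card
    (Finset.monotone_filter_right _ fun x _ (hx : x ⊆ S) => hx.trans h)

theorem below_le (A : Finset (Finset ι)) (T : Finset ι) : below A T ≤ 2 ^ T.card := by
  unfold below
  have : (A.filter (· ⊆ T)).card ≤ T.powerset.card :=
    Finset.card_le_card fun x hx => by simpa using (Finset.mem_filter.1 hx).2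
  rw [Finset.card_powerset] at this
  exact_mod_cast this

/-- The character of the coordinate `i`. -/
noncomputable def sgn (i : ι) (x : Finset ι) : ℝ := if i ∈ x then -1 else 1

theorem sum_sgn (A : Finset (Finset ι)) (T : Finset ι) (i : ι) :
    ∑ x ∈ A.filter (· ⊆ T), sgn i x = 2 * below A (T.erase i) - below A T := by
  have h1 : A.filter (· ⊆ T.erase i) = (A.filter (· ⊆ T)).filter (fun x => i ∉ x) := by
    ext x; simp [Finset.subset_erase, and_assoc]
  have h2 : ∀ x, sgn i x = 2 * (if i ∉ x then 1 else 0) - 1 := by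
    intro x; unfold sgn; split_ifs <;> norm_num
  unfold below
  rw [h1, Finset.sum_congr rfl fun x _ => h2 x, Finset.sum_sub_distrib, ← Finset.mul_sum,
    Finset.sum_boole]
  simp

/-- The sum factors over the coordinates, and `cosh v ≤ exp (v ^ 2 / 2)` bounds each factor. -/
theorem sum_exp_sgn (T : Finset ι) (v : ι → ℝ) :
    ∑ x ∈ T.powerset, Real.exp (∑ i ∈ T, v i * sgn i x)
      ≤ 2 ^ T.card * Real.exp ((∑ i ∈ T, v i ^ 2) / 2) := by
  have h1 : ∀ x ∈ T.powerset, Real.exp (∑ i ∈ T, v i * sgn i x)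
      = (∏ i ∈ x, Real.exp (-v i)) * ∏ i ∈ T \ x, Real.exp (v i) := by
    intro x hx
    rw [Real.exp_sum, ← Finset.prod_sdiff (Finset.mem_powerset.1 hx), mul_comm]
    congr 1
    · exact Finset.prod_congr rfl fun i hi => by simp [sgn, hi]
    · exact Finset.prod_congr rfl fun i hi => by simp [sgn, (Finset.mem_sdiff.1 hi).2]
  rw [Finset.sum_congr rfl h1, ← Finset.prod_add, Finset.sum_div, Real.exp_sum,
    ← Finset.prod_const, ← Finset.prod_mul_distrib]
  refine Finset.prod_le_prod (fun i _ => by positivity) fun i _ => ?_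
  have := Real.cosh_le_exp_half_sq (v i)
  rw [Real.cosh_eq] at this
  linarith

/-- The level-one inequality: a large family of subsets of `T` is nearly unbiased in most
coordinates. -/
theorem level_one (A : Finset (Finset ι)) (T : Finset ι) (hN : 0 < below A T) :
    Real.exp ((∑ i ∈ T, ((2 * below A (T.erase i) - below A T) / below A T) ^ 2) / 2) * below A T
      ≤ 2 ^ T.card := by
  set N := below A T with hNdef
  -- The mean of `sgn i` over the members of `A` below `T`. Using the biases themselves as
  -- coefficients makes the linear form average to `W`.
  set v : ι → ℝ := fun i => (2 * below A (T.erase i) - N) / N with hv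
  set W := ∑ i ∈ T, v i ^ 2 with hW
  change Real.exp (W / 2) * N ≤ _
  have hsum : ∑ x ∈ A.filter (· ⊆ T), ∑ i ∈ T, v i * sgn i x = N * W := by
    rw [Finset.sum_comm, hW, Finset.mul_sum]
    refine Finset.sum_congr rfl fun i _ => ?_
    rw [← Finset.mul_sum, sum_sgn]
    have : 2 * below A (T.erase i) - below A T = N * v i := by
      simp only [hv]; field_simp; rfl
    rw [this]; ring
  -- Jensen's inequality, by the tangent of `exp` at the mean `W`.
  have hlow : N * Real.exp W ≤ ∑ x ∈ A.filter (· ⊆ T), Real.exp (∑ i ∈ T, v i * sgn i x) := by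
    have h1 : ∀ x ∈ A.filter (· ⊆ T), Real.exp W * (1 + ((∑ i ∈ T, v i * sgn i x) - W))
        ≤ Real.exp (∑ i ∈ T, v i * sgn i x) := by
      intro x _
      have h2 := Real.add_one_le_exp ((∑ i ∈ T, v i * sgn i x) - W)
      calc _ ≤ Real.exp W * Real.exp ((∑ i ∈ T, v i * sgn i x) - W) := by gcongr; linarith
        _ = _ := by rw [← Real.exp_add]; congr 1; ring
    refine le_trans (le_of_eq ?_) (Finset.sum_le_sum h1)
    rw [← Finset.mul_sum, Finset.sum_add_distrib, Finset.sum_sub_distrib, hsum]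
    simp only [Finset.sum_const, nsmul_eq_mul]
    change _ = Real.exp W * (N * 1 + (N * W - N * W))
    ring
  have hup : ∑ x ∈ A.filter (· ⊆ T), Real.exp (∑ i ∈ T, v i * sgn i x)
      ≤ 2 ^ T.card * Real.exp (W / 2) := by
    refine le_trans (Finset.sum_le_sum_of_subset_of_nonneg (fun x hx => ?_) fun _ _ _ => ?_)
      (sum_exp_sgn T v)
    · simpa using (Finset.mem_filter.1 hx).2
    · positivity
  have h3 : Real.exp W = Real.exp (W / 2) * Real.exp (W / 2) := by
    rw [← Real.exp_add]; congr 1; ring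
  rw [h3] at hlow
  have h4 := hlow.trans hup
  have h5 : 0 < Real.exp (W / 2) := Real.exp_pos _
  nlinarith

/-- The density below which a family is neglected. -/
noncomputable def negl (m : ℕ) : ℝ := Real.exp (-(m : ℝ) / 20000)

/-- A coordinate is bad if its bias towards absence exceeds `1 / 10`. A sparse family is absorbed by
the additive term; for the others `level_one` leaves at most one coordinate in a hundred with a bias
beyond `1 / 10` in absolute value. -/
theorem bad_sum_le (A : Finset (Finset ι)) (T : Finset ι) :
    ∑ i ∈ T.filter (fun i => 11 * (below A T - below A (T.erase i)) < 9 * below A (T.erase i)),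
        below A (T.erase i)
      ≤ (1 / 40) * ∑ i ∈ T, below A (T.erase i) + T.card * (negl T.card * 2 ^ T.card) := by
  set m := T.card with hm
  set N := below A T with hN
  have hle : ∀ i, below A (T.erase i) ≤ N := fun i => below_mono A (Finset.erase_subset _ _)
  have hα : 0 < negl m := Real.exp_pos _
  have hS0 : 0 ≤ ∑ i ∈ T, below A (T.erase i) := Finset.sum_nonneg fun i _ => below_nonneg _ _
  by_cases hc : N < negl m * 2 ^ m
  · have : ∑ i ∈ T.filter (fun i => 11 * (N - below A (T.erase i)) < 9 * below A (T.erase i)),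
        below A (T.erase i) ≤ m * N := by
      refine (Finset.sum_le_sum fun i _ => hle i).trans ?_
      rw [Finset.sum_const, nsmul_eq_mul]
      refine mul_le_mul_of_nonneg_right ?_ (below_nonneg _ _)
      exact_mod_cast Finset.card_le_card (Finset.filter_subset _ T)
    have h2 : (m : ℝ) * N ≤ m * (negl m * 2 ^ m) := by gcongr
    linarith
  · push Not at hc
    have hNpos : 0 < N := lt_of_lt_of_le (by positivity) hc
    set v : ι → ℝ := fun i => (2 * below A (T.erase i) - N) / N with hv
    have hvN : ∀ i, 2 * below A (T.erase i) - N = v i * N := fun i => by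
      simp only [hv]; field_simp
    have hlev : Real.exp ((∑ i ∈ T, v i ^ 2) / 2) * N ≤ 2 ^ m := level_one A T hNpos
    -- Density at least `exp (-m / 20000)` bounds `exp (W / 2)` by `exp (m / 20000)`.
    have hW : ∑ i ∈ T, v i ^ 2 ≤ m / 10000 := by
      have h1 : Real.exp ((∑ i ∈ T, v i ^ 2) / 2) * negl m ≤ 1 := by
        have h2 : Real.exp ((∑ i ∈ T, v i ^ 2) / 2) * (negl m * 2 ^ m) ≤ 2 ^ m :=
          le_trans (by gcongr) hlev
        have h3 : (0 : ℝ) < 2 ^ m := by positivity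
        by_contra hcon
        push Not at hcon
        nlinarith
      rw [negl, ← Real.exp_add, ← Real.exp_zero, Real.exp_le_exp] at h1
      linarith
    set big := T.filter (fun i => 1 / 100 < v i ^ 2) with hbig
    have hbigc : (big.card : ℝ) ≤ m / 100 := by
      have h1 : ∑ i ∈ big, (1 / 100 : ℝ) ≤ ∑ i ∈ T, v i ^ 2 :=
        (Finset.sum_le_sum fun i hi => (Finset.mem_filter.1 hi).2.le).trans
          (Finset.sum_le_sum_of_subset_of_nonneg (Finset.filter_subset _ _)
            fun i _ _ => sq_nonneg _)
      rw [Finset.sum_const, nsmul_eq_mul] at h1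
      linarith
    have hbad : T.filter (fun i => 11 * (N - below A (T.erase i)) < 9 * below A (T.erase i))
        ⊆ big := by
      intro i hi
      rw [Finset.mem_filter] at hi
      refine Finset.mem_filter.2 ⟨hi.1, ?_⟩
      have h1 := hvN i
      have h2 : (1 / 10) * N < v i * N := by linarith [hi.2]
      have h3 : 1 / 10 < v i := lt_of_mul_lt_mul_right h2 hNpos.le
      nlinarith
    have hB : ∑ i ∈ T.filter (fun i => 11 * (N - below A (T.erase i)) < 9 * below A (T.erase i)),
        below A (T.erase i) ≤ m / 100 * N := by
      refine (Finset.sum_le_sum fun i _ => hle i).trans ?_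
      rw [Finset.sum_const, nsmul_eq_mul]
      gcongr
      refine le_trans ?_ hbigc
      exact_mod_cast Finset.card_le_card hbad
    have hG : (m - m / 100) * (9 / 20 * N) ≤ ∑ i ∈ T, below A (T.erase i) := by
      have h1 : ∑ i ∈ T \ big, (9 / 20 * N) ≤ ∑ i ∈ T, below A (T.erase i) := by
        refine (Finset.sum_le_sum fun i hi => ?_).trans
          (Finset.sum_le_sum_of_subset_of_nonneg Finset.sdiff_subset
            fun i _ _ => below_nonneg _ _)
        rw [Finset.mem_sdiff, hbig, Finset.mem_filter, not_and, not_lt] at hi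
        have h2 := hi.2 hi.1
        have h3 : -(1 / 10) ≤ v i := by
          by_contra hcon
          push Not at hcon
          nlinarith
        have h4 := hvN i
        have h5 : -(1 / 10) * N ≤ v i * N := mul_le_mul_of_nonneg_right h3 hNpos.le
        linarith
      rw [Finset.sum_const, nsmul_eq_mul] at h1
      refine le_trans ?_ h1
      gcongr
      rw [Finset.card_sdiff_of_subset (Finset.filter_subset _ _),
        Nat.cast_sub (Finset.card_le_card (Finset.filter_subset _ _))]
      linarith
    have hm0 : (0 : ℝ) ≤ m := Nat.cast_nonneg m
    have h9 : (0 : ℝ) ≤ m * (negl m * 2 ^ m) :=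
      mul_nonneg hm0 (mul_nonneg hα.le (pow_nonneg zero_le_two m))
    -- The constants fit because `1 / 100 ≤ (1 / 40) * (99 / 100) * (9 / 20)`.
    nlinarith [mul_nonneg hm0 hNpos.le]

/-! ### Corruption of rectangles under the hard distribution -/

section

variable [Fintype ι]

/-- Sets of size `m` with a marked element. -/
def marked (ι : Type*) [DecidableEq ι] [Fintype ι] (m : ℕ) : Finset (Finset ι × ι) :=
  Finset.univ.filter fun p => p.1.card = m ∧ p.2 ∈ p.1

theorem mem_marked {m : ℕ} {p : Finset ι × ι} :
    p ∈ marked ι m ↔ p.1.card = m ∧ p.2 ∈ p.1 := by simp [marked]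

/-- The complement, enlarged by the marked element. -/
def flip (p : Finset ι × ι) : Finset ι × ι := (insert p.2 p.1ᶜ, p.2)

theorem flip_flip {p : Finset ι × ι} (h : p.2 ∈ p.1) : flip (flip p) = p := by
  obtain ⟨T, i⟩ := p
  simp only [flip, Prod.mk.injEq, and_true]
  ext j
  by_cases hj : j = i
  · subst hj; simpa using h
  · simp [hj]

theorem flip_mem {m : ℕ} (hm : Fintype.card ι + 1 = 2 * m) {p : Finset ι × ι}
    (h : p ∈ marked ι m) : flip p ∈ marked ι m := by
  rw [mem_marked] at *
  refine ⟨?_, Finset.mem_insert_self _ _⟩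
  rw [flip, Finset.card_insert_of_notMem (by simpa using h.2), Finset.card_compl, h.1]
  omega

/-- In a universe of size `2 * m - 1` flipping is an involution that exchanges the roles of Alice
and Bob, so an estimate for one party serves for the other. -/
theorem sum_flip {m : ℕ} (hm : Fintype.card ι + 1 = 2 * m) (F : Finset ι × ι → ℝ) :
    ∑ p ∈ marked ι m, F (flip p) = ∑ p ∈ marked ι m, F p :=
  Finset.sum_nbij' flip flip (fun _ h => flip_mem hm h) (fun _ h => flip_mem hm h)
    (fun _ h => flip_flip (mem_marked.1 h).2) (fun _ h => flip_flip (mem_marked.1 h).2)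
    fun _ _ => rfl

theorem sum_marked (m : ℕ) (F : Finset ι → ι → ℝ) :
    ∑ p ∈ marked ι m, F p.1 p.2 = ∑ T ∈ Finset.univ.powersetCard m, ∑ i ∈ T, F T i := by
  rw [Finset.sum_sigma']
  refine Finset.sum_nbij' (fun p => ⟨p.1, p.2⟩) (fun p => (p.1, p.2)) ?_ ?_ ?_ ?_ ?_
  · intro p hp; simpa [mem_marked] using hp
  · intro p hp; simpa [mem_marked] using hp
  all_goals intros; rfl

/-- The other party's weight `g` depends on `T` but not on the marked element, so `bad_sum_le`
applies for each fixed `T`. -/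
theorem sum_marked_bad_le {m : ℕ} (A : Finset (Finset ι)) (g : Finset ι → ℝ)
    (hg : ∀ T, T.card = m → 0 ≤ g T ∧ g T ≤ 2 ^ (m - 1)) (hm : 1 ≤ m) :
    ∑ p ∈ (marked ι m).filter (fun p =>
        11 * (below A p.1 - below A (p.1.erase p.2)) < 9 * below A (p.1.erase p.2)),
      below A (p.1.erase p.2) * g p.1
      ≤ (1 / 40) * ∑ p ∈ marked ι m, below A (p.1.erase p.2) * g p.1
        + 2 * negl m * ((marked ι m).card * 4 ^ (m - 1)) := by
  rw [Finset.sum_filter, sum_marked m (fun T i =>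
      if 11 * (below A T - below A (T.erase i)) < 9 * below A (T.erase i)
      then below A (T.erase i) * g T else 0),
    sum_marked m (fun T i => below A (T.erase i) * g T), Finset.card_eq_sum_ones,
    Nat.cast_sum, sum_marked m (fun _ _ => ((1 : ℕ) : ℝ)), Finset.sum_mul, Finset.mul_sum,
    Finset.mul_sum, ← Finset.sum_add_distrib]
  refine Finset.sum_le_sum fun T hT => ?_
  have hTc : T.card = m := (Finset.mem_powersetCard.1 hT).2
  obtain ⟨h0, h1⟩ := hg T hTc
  have hb := bad_sum_le A T
  rw [hTc] at hb
  rw [← Finset.sum_filter, ← Finset.sum_mul, ← Finset.sum_mul]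
  have h2 := mul_le_mul_of_nonneg_right hb h0
  have h3 : m * (negl m * 2 ^ m) * g T ≤ m * (negl m * 2 ^ m) * 2 ^ (m - 1) := by
    have : 0 ≤ negl m := (Real.exp_pos _).le
    gcongr
  have h4 : (m : ℝ) * (negl m * 2 ^ m) * 2 ^ (m - 1) = 2 * negl m * (m * 4 ^ (m - 1)) := by
    obtain ⟨k, rfl⟩ : ∃ k, m = k + 1 := ⟨m - 1, by omega⟩
    rw [show (4 : ℝ) = 2 * 2 by norm_num, Nat.add_sub_cancel, mul_pow]; ring
  have h5 : ∑ i ∈ T, ((1 : ℕ) : ℝ) = m := by simp [hTc]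
  rw [h5]
  linarith

/-- The mass of a rectangle on disjoint pairs is dominated by its mass on pairs which meet in
exactly one point. -/
theorem corruption {m : ℕ} (hm : Fintype.card ι + 1 = 2 * m) (A B : Finset (Finset ι)) :
    (3 / 5) * ∑ p ∈ marked ι m, below A (p.1.erase p.2) * below B p.1ᶜ
        - 4 * negl m * ((marked ι m).card * 4 ^ (m - 1))
      ≤ ∑ p ∈ marked ι m, (below A p.1 - below A (p.1.erase p.2))
          * (below B (insert p.2 p.1ᶜ) - below B p.1ᶜ) := by
  have hm1 : 1 ≤ m := by omega
  have hcompl : ∀ T : Finset ι, T.card = m → Tᶜ.card = m - 1 := fun T hT => by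
    rw [Finset.card_compl, hT]; omega
  have hg : ∀ C : Finset (Finset ι), ∀ T : Finset ι, T.card = m →
      0 ≤ below C Tᶜ ∧ below C Tᶜ ≤ 2 ^ (m - 1) := fun C T hT =>
    ⟨below_nonneg _ _, by rw [← hcompl T hT]; exact below_le _ _⟩
  have hA := sum_marked_bad_le A (fun T => below B Tᶜ) (hg B) hm1
  have hB := sum_marked_bad_le B (fun T => below A Tᶜ) (hg A) hm1
  have hfl : ∀ p ∈ marked ι m, (flip p).1.erase (flip p).2 = p.1ᶜ ∧
      (flip p).1ᶜ = p.1.erase p.2 := by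
    intro p hp
    have h := (mem_marked.1 hp).2
    constructor
    · rw [flip, Finset.erase_insert (by simpa using h)]
    · simp [flip, Finset.compl_insert]
  rw [Finset.sum_filter, ← sum_flip hm, ← sum_flip hm (fun p => below B (p.1.erase p.2) * _)] at hB
  have e1 : ∑ p ∈ marked ι m, below B ((flip p).1.erase (flip p).2) * below A (flip p).1ᶜ
      = ∑ p ∈ marked ι m, below A (p.1.erase p.2) * below B p.1ᶜ :=
    Finset.sum_congr rfl fun p hp => by rw [(hfl p hp).1, (hfl p hp).2, mul_comm]
  have e2 : ∑ p ∈ marked ι m, (if 11 * (below B (flip p).1 - below B ((flip p).1.erase (flip p).2))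
        < 9 * below B ((flip p).1.erase (flip p).2)
      then below B ((flip p).1.erase (flip p).2) * below A (flip p).1ᶜ else 0)
      = ∑ p ∈ marked ι m, (if 11 * (below B (insert p.2 p.1ᶜ) - below B p.1ᶜ) < 9 * below B p.1ᶜ
      then below A (p.1.erase p.2) * below B p.1ᶜ else 0) :=
    Finset.sum_congr rfl fun p hp => by
      rw [(hfl p hp).1, (hfl p hp).2, mul_comm (below B p.1ᶜ)]; rfl
  rw [e1, e2] at hB
  rw [Finset.sum_filter] at hA
  -- At a point good for both parties each factor retains `9 / 11`, whence `81 / 121`; at a bad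
  -- point the left side is at most zero. Removing two bad parts of `1 / 40` each still leaves more
  -- than `3 / 5`.
  have hpt : ∀ p ∈ marked ι m, (81 / 121) * (below A (p.1.erase p.2) * below B p.1ᶜ
      - (if 11 * (below A p.1 - below A (p.1.erase p.2)) < 9 * below A (p.1.erase p.2)
          then below A (p.1.erase p.2) * below B p.1ᶜ else 0)
      - (if 11 * (below B (insert p.2 p.1ᶜ) - below B p.1ᶜ) < 9 * below B p.1ᶜ
      then below A (p.1.erase p.2) * below B p.1ᶜ else 0))
      ≤ (below A p.1 - below A (p.1.erase p.2))
          * (below B (insert p.2 p.1ᶜ) - below B p.1ᶜ) := by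
    intro p _
    have a0 := below_nonneg A (p.1.erase p.2)
    have b0 := below_nonneg B p.1ᶜ
    have a1 := below_mono A (Finset.erase_subset p.2 p.1)
    have b1 := below_mono B (Finset.subset_insert p.2 p.1ᶜ)
    have ab := mul_nonneg a0 b0
    have ab1 := mul_nonneg (sub_nonneg.2 a1) (sub_nonneg.2 b1)
    split_ifs with h1 h2 h2
    · linarith
    · linarith
    · linarith
    · have := mul_le_mul (not_lt.1 h1) (not_lt.1 h2) (by positivity) (by linarith)
      linarith
  have hs := Finset.sum_le_sum hpt
  rw [← Finset.mul_sum, Finset.sum_sub_distrib, Finset.sum_sub_distrib] at hs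
  have hn : 0 ≤ negl m * ((marked ι m).card * 4 ^ (m - 1)) := by
    have : 0 ≤ negl m := (Real.exp_pos _).le
    positivity
  have hp : 0 ≤ ∑ p ∈ marked ι m, below A (p.1.erase p.2) * below B p.1ᶜ :=
    Finset.sum_nonneg fun p _ => mul_nonneg (below_nonneg _ _) (below_nonneg _ _)
  linarith

end

/-! ### From rectangles to randomized protocols -/

theorem card_filter_mem (A : Finset (Finset ι)) (T : Finset ι) (i : ι) :
    (((T.powerset.filter (i ∈ ·)).filter (· ∈ A)).card : ℝ) = below A T - below A (T.erase i) := by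
  have h : A.filter (· ⊆ T) = (T.powerset.filter (i ∈ ·)).filter (· ∈ A)
      ∪ A.filter (· ⊆ T.erase i) := by
    ext x
    simp only [Finset.mem_filter, Finset.mem_union, Finset.mem_powerset, Finset.subset_erase]
    tauto
  have hd : Disjoint ((T.powerset.filter (i ∈ ·)).filter (· ∈ A)) (A.filter (· ⊆ T.erase i)) := by
    rw [Finset.disjoint_left]
    intro x hx hx'
    simp only [Finset.mem_filter, Finset.subset_erase] at hx hx'
    exact hx'.2.2 hx.1.2
  unfold below
  rw [h, Finset.card_union_of_disjoint hd]
  push_cast; ring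

variable [Fintype ι]

/-- Pairs of disjoint sets, separated by the marked set and avoiding its marked element. -/
def disjointPairs (p : Finset ι × ι) : Finset (Finset ι × Finset ι) :=
  (p.1.erase p.2).powerset ×ˢ p.1ᶜ.powerset

/-- Pairs of sets, separated by the marked set except that both contain its marked element. -/
def touchingPairs (p : Finset ι × ι) : Finset (Finset ι × Finset ι) :=
  (p.1.powerset.filter (p.2 ∈ ·)) ×ˢ ((insert p.2 p.1ᶜ).powerset.filter (p.2 ∈ ·))

theorem card_disjointPairs_filter (A B : Finset (Finset ι)) (p : Finset ι × ι) :
    (((disjointPairs p).filter (fun z => z.1 ∈ A ∧ z.2 ∈ B)).card : ℝ)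
      = below A (p.1.erase p.2) * below B p.1ᶜ := by
  have h : ∀ (C : Finset (Finset ι)) (T : Finset ι), T.powerset.filter (· ∈ C)
      = C.filter (· ⊆ T) := by
    intro C T; ext x; simp [and_comm]
  rw [disjointPairs, Finset.filter_product (fun x => x ∈ A) (fun y => y ∈ B), Finset.card_product,
    h, h]
  push_cast; rfl

theorem card_touchingPairs_filter (A B : Finset (Finset ι)) {p : Finset ι × ι} (hp : p.2 ∈ p.1) :
    (((touchingPairs p).filter (fun z => z.1 ∈ A ∧ z.2 ∈ B)).card : ℝ)
      = (below A p.1 - below A (p.1.erase p.2)) * (below B (insert p.2 p.1ᶜ) - below B p.1ᶜ) := by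
  rw [touchingPairs, Finset.filter_product (fun x => x ∈ A) (fun y => y ∈ B), Finset.card_product]
  push_cast
  rw [card_filter_mem, card_filter_mem, Finset.erase_insert (by simpa using hp)]

theorem card_disjointPairs {m : ℕ} (hm : Fintype.card ι + 1 = 2 * m) {p : Finset ι × ι}
    (hp : p ∈ marked ι m) : (disjointPairs p).card = 4 ^ (m - 1) := by
  rw [mem_marked] at hp
  rw [disjointPairs, Finset.card_product, Finset.card_powerset, Finset.card_powerset,
    Finset.card_erase_of_mem hp.2, Finset.card_compl, hp.1,
    show Fintype.card ι - m = m - 1 by omega, ← mul_pow]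
  norm_num

theorem card_touchingPairs {m : ℕ} (hm : Fintype.card ι + 1 = 2 * m) {p : Finset ι × ι}
    (hp : p ∈ marked ι m) : (touchingPairs p).card = 4 ^ (m - 1) := by
  have key : ∀ (T : Finset ι) (i : ι), i ∈ T →
      (T.powerset.filter (i ∈ ·)).card = 2 ^ (T.card - 1) := by
    intro T i hi
    have h1 := Finset.card_filter_add_card_filter_not (s := T.powerset) (i ∈ ·)
    have h2 : T.powerset.filter (fun x => i ∉ x) = (T.erase i).powerset := by
      ext x; simp [Finset.subset_erase]
    rw [h2, Finset.card_powerset, Finset.card_powerset, Finset.card_erase_of_mem hi] at h1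
    have h3 : 2 ^ T.card = 2 * 2 ^ (T.card - 1) := by
      rw [← pow_succ', Nat.sub_add_cancel (Finset.card_pos.2 ⟨i, hi⟩)]
    omega
  rw [touchingPairs, Finset.card_product, key _ _ (mem_marked.1 hp).2,
    key _ _ (Finset.mem_insert_self _ _), show (insert p.2 p.1ᶜ).card = m from
      (mem_marked.1 (flip_mem hm hp)).1, (mem_marked.1 hp).1, ← mul_pow]
  norm_num

/-- The corruption bound for a set of pairs which is partitioned into rectangles. -/
theorem partition_corruption {m : ℕ} (hm : Fintype.card ι + 1 = 2 * m) {Θ : Type*} [Fintype Θ]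
    (No : Finset ι → Finset ι → Prop) [∀ x y, Decidable (No x y)] (tr : Finset ι → Finset ι → Θ)
    (hrect : ∀ x y x' y', No x y → No x' y' → tr x y = tr x' y' → No x y' ∧ tr x y' = tr x y) :
    (3 / 5) * ∑ p ∈ marked ι m, (((disjointPairs p).filter (fun z => No z.1 z.2)).card : ℝ)
        - 4 * negl m * ((marked ι m).card * 4 ^ (m - 1)) * Fintype.card Θ
      ≤ ∑ p ∈ marked ι m, (((touchingPairs p).filter (fun z => No z.1 z.2)).card : ℝ) := by
  classical
  set A : Θ → Finset (Finset ι) := fun τ => Finset.univ.filter fun x => ∃ y, No x y ∧ tr x y = τ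
  set B : Θ → Finset (Finset ι) := fun τ => Finset.univ.filter fun y => ∃ x, No x y ∧ tr x y = τ
  -- The pairs answered No with a given transcript form a rectangle.
  have hAB : ∀ τ x y, (No x y ∧ tr x y = τ) ↔ (x ∈ A τ ∧ y ∈ B τ) := by
    intro τ x y
    simp only [A, B, Finset.mem_filter, Finset.mem_univ, true_and]
    constructor
    · exact fun h => ⟨⟨y, h⟩, ⟨x, h⟩⟩
    · rintro ⟨⟨y', h1, h2⟩, ⟨x', h3, h4⟩⟩
      obtain ⟨h5, h6⟩ := hrect x y' x' y h1 h3 (h2.trans h4.symm)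
      exact ⟨h5, h6.trans h2⟩
  have hsplit : ∀ Z : Finset (Finset ι × Finset ι),
      ((Z.filter (fun z => No z.1 z.2)).card : ℝ)
        = ∑ τ, ((Z.filter (fun z => z.1 ∈ A τ ∧ z.2 ∈ B τ)).card : ℝ) := by
    intro Z
    rw [Finset.card_eq_sum_card_fiberwise (f := fun z => tr z.1 z.2) (t := Finset.univ)
      (fun _ _ => Finset.mem_coe.2 (Finset.mem_univ _))]
    push_cast
    refine Finset.sum_congr rfl fun τ _ => ?_
    rw [Finset.filter_filter]
    simp only [hAB]
  simp only [hsplit]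
  rw [Finset.sum_comm, Finset.sum_comm (s := marked ι m)]
  have h1 : ∀ τ : Θ, (3 / 5) * ∑ p ∈ marked ι m,
      (((disjointPairs p).filter (fun z => z.1 ∈ A τ ∧ z.2 ∈ B τ)).card : ℝ)
        - 4 * negl m * ((marked ι m).card * 4 ^ (m - 1))
      ≤ ∑ p ∈ marked ι m,
        (((touchingPairs p).filter (fun z => z.1 ∈ A τ ∧ z.2 ∈ B τ)).card : ℝ) := by
    intro τ
    refine le_trans (le_of_eq ?_) ((corruption hm (A τ) (B τ)).trans (le_of_eq ?_))
    · simp only [card_disjointPairs_filter]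
    · exact Finset.sum_congr rfl fun p hp =>
        (card_touchingPairs_filter _ _ (mem_marked.1 hp).2).symm
  refine le_trans (le_of_eq ?_) (Finset.sum_le_sum fun τ _ => h1 τ)
  rw [Finset.sum_sub_distrib, ← Finset.mul_sum, Finset.sum_const, Finset.card_univ, nsmul_eq_mul]
  ring

theorem integral_card_filter {Ω : Type*} [MeasurableSpace Ω] (μ : Measure Ω) [IsFiniteMeasure μ]
    {X : Type*} (Z : Finset X) (No : Ω → X → Prop) [∀ ω x, Decidable (No ω x)]
    (h : ∀ z ∈ Z, MeasurableSet {ω | No ω z}) :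
    Integrable (fun ω => ((Z.filter (No ω)).card : ℝ)) μ ∧
      ∫ ω, ((Z.filter (No ω)).card : ℝ) ∂μ = ∑ z ∈ Z, μ.real {ω | No ω z} := by
  have e : (fun ω => ((Z.filter (No ω)).card : ℝ))
      = fun ω => ∑ z ∈ Z, ({ω | No ω z}.indicator (fun _ => (1 : ℝ)) ω) := by
    funext ω
    rw [Finset.card_filter]
    push_cast
    exact Finset.sum_congr rfl fun z _ => by simp [Set.indicator_apply]
  have hi : ∀ z ∈ Z, Integrable ({ω | No ω z}.indicator (fun _ => (1 : ℝ))) μ :=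
    fun z hz => (integrable_const _).indicator (h z hz)
  rw [e]
  refine ⟨integrable_finsetSum _ hi, ?_⟩
  rw [integral_finsetSum _ hi]
  refine Finset.sum_congr rfl fun z hz => ?_
  rw [integral_indicator_const _ (h z hz)]
  simp

/-- The linear lower bound for the randomized communication complexity of set disjointness, for
public coin protocols given by their transcripts. -/
theorem exp_le_card_transcripts {m : ℕ} (hm : Fintype.card ι + 1 = 2 * m)
    {Ω : Type*} [MeasurableSpace Ω] (μ : Measure Ω) [IsProbabilityMeasure μ]
    {Θ : Type*} [Fintype Θ] (No : Ω → Finset ι → Finset ι → Prop)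
    (tr : Ω → Finset ι → Finset ι → Θ)
    (hrect : ∀ ω x y x' y', No ω x y → No ω x' y' → tr ω x y = tr ω x' y' →
      No ω x y' ∧ tr ω x y' = tr ω x y)
    (h0 : ∀ x y, Disjoint x y → MeasurableSet {ω | No ω x y} ∧ 2 / 3 ≤ μ.real {ω | No ω x y})
    (h1 : ∀ x y, ¬ Disjoint x y → MeasurableSet {ω | No ω x y} ∧ μ.real {ω | No ω x y} ≤ 1 / 3) :
    Real.exp ((m : ℝ) / 20000) ≤ 60 * Fintype.card Θ := by
  classical
  have d0 : ∀ p ∈ marked ι m, ∀ z ∈ disjointPairs p, Disjoint z.1 z.2 := by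
    intro p _ z hz
    rw [disjointPairs, Finset.mem_product, Finset.mem_powerset, Finset.mem_powerset] at hz
    exact Finset.disjoint_left.2 fun j hj hj' =>
      (Finset.mem_compl.1 (hz.2 hj')) (Finset.mem_of_mem_erase (hz.1 hj))
  have d1 : ∀ p ∈ marked ι m, ∀ z ∈ touchingPairs p, ¬ Disjoint z.1 z.2 := by
    intro p _ z hz
    simp only [touchingPairs, Finset.mem_product, Finset.mem_filter] at hz
    exact fun h => Finset.disjoint_left.1 h hz.1.2 hz.2.2
  set K : ℝ := (marked ι m).card * 4 ^ (m - 1) with hK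
  have hKpos : 0 < K := by
    have : (marked ι m).Nonempty := by
      obtain ⟨T, -, hT⟩ := Finset.exists_subset_card_eq
        (s := (Finset.univ : Finset ι)) (n := m) (by rw [Finset.card_univ]; omega)
      obtain ⟨i, hi⟩ : T.Nonempty := Finset.card_pos.1 (by omega)
      exact ⟨(T, i), mem_marked.2 ⟨hT, hi⟩⟩
    have : 0 < (marked ι m).card := this.card_pos
    positivity
  have i0 : ∀ p ∈ marked ι m, _ := fun p hp => integral_card_filter μ (disjointPairs p)
    (fun ω z => No ω z.1 z.2) (fun z hz => (h0 _ _ (d0 p hp z hz)).1)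
  have i1 : ∀ p ∈ marked ι m, _ := fun p hp => integral_card_filter μ (touchingPairs p)
    (fun ω z => No ω z.1 z.2) (fun z hz => (h1 _ _ (d1 p hp z hz)).1)
  -- The corruption bound holds for each outcome of the coins and is averaged over them.
  have hmono : ∫ ω, ((3 / 5) * ∑ p ∈ marked ι m,
        (((disjointPairs p).filter (fun z => No ω z.1 z.2)).card : ℝ)
        - 4 * negl m * K * Fintype.card Θ) ∂μ
      ≤ ∫ ω, ∑ p ∈ marked ι m,
        (((touchingPairs p).filter (fun z => No ω z.1 z.2)).card : ℝ) ∂μ := by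
    refine integral_mono ?_ ?_ fun ω => partition_corruption hm (No ω) (tr ω) (hrect ω)
    · exact ((integrable_finsetSum _ fun p hp => (i0 p hp).1).const_mul _).sub
        (integrable_const _)
    · exact integrable_finsetSum _ fun p hp => (i1 p hp).1
  rw [integral_sub ((integrable_finsetSum _ fun p hp => (i0 p hp).1).const_mul _)
    (integrable_const _), integral_const_mul, integral_finsetSum _ fun p hp => (i0 p hp).1,
    integral_finsetSum _ fun p hp => (i1 p hp).1, integral_const, probReal_univ, one_smul] at hmono
  have b0 : 2 / 3 * K ≤ ∑ p ∈ marked ι m, ∫ ω,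
      (((disjointPairs p).filter (fun z => No ω z.1 z.2)).card : ℝ) ∂μ := by
    have : ∀ p ∈ marked ι m, (2 / 3 : ℝ) * 4 ^ (m - 1) ≤ ∫ ω,
        (((disjointPairs p).filter (fun z => No ω z.1 z.2)).card : ℝ) ∂μ := by
      intro p hp
      rw [(i0 p hp).2]
      have := Finset.card_nsmul_le_sum (disjointPairs p) (fun z => μ.real {ω | No ω z.1 z.2})
        (2 / 3) fun z hz => (h0 _ _ (d0 p hp z hz)).2
      rw [card_disjointPairs hm hp, nsmul_eq_mul] at this
      push_cast at this
      linarith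
    have := Finset.card_nsmul_le_sum _ _ _ this
    rw [nsmul_eq_mul] at this
    linarith
  have b1 : ∑ p ∈ marked ι m, ∫ ω,
      (((touchingPairs p).filter (fun z => No ω z.1 z.2)).card : ℝ) ∂μ ≤ 1 / 3 * K := by
    have : ∀ p ∈ marked ι m, ∫ ω,
        (((touchingPairs p).filter (fun z => No ω z.1 z.2)).card : ℝ) ∂μ
        ≤ (1 / 3 : ℝ) * 4 ^ (m - 1) := by
      intro p hp
      rw [(i1 p hp).2]
      have := Finset.sum_le_card_nsmul (touchingPairs p) (fun z => μ.real {ω | No ω z.1 z.2})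
        (1 / 3) fun z hz => (h1 _ _ (d1 p hp z hz)).2
      rw [card_touchingPairs hm hp, nsmul_eq_mul] at this
      push_cast at this
      linarith
    have := Finset.sum_le_card_nsmul _ _ _ this
    rw [nsmul_eq_mul] at this
    linarith
  -- The gap is `(3 / 5) * (2 / 3) - 1 / 3 = 1 / 15`, divided by the factor `4` of the error term.
  have hfin : 1 / 60 * K ≤ negl m * Fintype.card Θ * K := by linarith
  have hfin2 : 1 / 60 ≤ negl m * Fintype.card Θ := le_of_mul_le_mul_right hfin hKpos
  have he : Real.exp ((m : ℝ) / 20000) * negl m = 1 := by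
    rw [negl, ← Real.exp_add, ← Real.exp_zero]; congr 1; ring
  have := mul_le_mul_of_nonneg_left hfin2 (Real.exp_pos ((m : ℝ) / 20000)).le
  rw [← mul_assoc, he] at this
  linarith

end SetDisjointness

/-! ### Simulation of an algorithm by two parties -/

namespace Congest

/-- A family of networks with a fixed set of Alice's nodes (`side p = true`), whose neighbourhoods
depend only on Alice's input, while those of the other nodes depend only on Bob's input. -/
structure IsTwoParty {V X Y : Type*} (H : X → Y → SimpleGraph V) (side : V → Bool) : Prop where
  left : ∀ x y y' p q, side p = true → (H x y).Adj p q → (H x y').Adj p q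
  right : ∀ x x' y p q, side p = false → (H x y).Adj p q → (H x' y).Adj p q

/-- A message of at most `B` bits as a word of length `B` over a three-letter alphabet. -/
def encode {B : ℕ} (w : Message B) : Fin B → Option Bool := fun i => w.1[(i : ℕ)]?

theorem encode_injective {B : ℕ} : Function.Injective (encode (B := B)) := by
  intro w w' h
  refine Subtype.ext (List.ext_getElem? fun i => ?_)
  by_cases hi : i < B
  · exact congrFun h ⟨i, hi⟩
  · rw [List.getElem?_eq_none (by have := w.2; omega),
      List.getElem?_eq_none (by have := w'.2; omega)]

section Simulation

variable {Ω : Type u} {n β B : ℕ} {X Y : Type*} (alg : Algorithm.{u, v} Ω n β B)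
  (H : X → Y → SimpleGraph (Fin n)) (ids : Fin n ↪ NodeId β) (E : Finset (Fin n × Fin n)) (R : ℕ)

/-- The messages sent along the directed edges in `E` during `R` rounds. -/
def transcript (ω : Ω) (x : X) (y : Y) : Fin R → E → Fin B → Option Bool := fun t e =>
  encode (alg.send (alg.state (H x y) ids ω t e.1.1) (ids e.1.2))

variable {alg H ids E R} {side : Fin n → Bool}

/-- By induction on the rounds: on the mixed input, Alice's nodes behave as in the first run and
Bob's as in the second. Messages within a side agree by induction, messages across the cut because
the transcripts agree. -/
theorem state_paste (hH : IsTwoParty H side)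
    (hE : ∀ x y p q, (H x y).Adj p q → side p ≠ side q → (p, q) ∈ E) {ω : Ω} {x x' : X} {y y' : Y}
    (htr : transcript alg H ids E R ω x y = transcript alg H ids E R ω x' y') :
    ∀ t ≤ R, ∀ p, (side p = true → alg.state (H x y') ids ω t p = alg.state (H x y) ids ω t p) ∧
      (side p = false → alg.state (H x y') ids ω t p = alg.state (H x' y') ids ω t p) := by
  have hadj : ∀ p q, side p = true → ((H x y').Adj p q ↔ (H x y).Adj p q) := fun p q hp =>
    ⟨hH.left x y' y p q hp, hH.left x y y' p q hp⟩
  have hadj' : ∀ p q, side p = false → ((H x y').Adj p q ↔ (H x' y').Adj p q) := fun p q hp =>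
    ⟨hH.right x x' y' p q hp, hH.right x' x y' p q hp⟩
  intro t
  induction t with
  | zero =>
    refine fun _ p => ⟨fun hp => ?_, fun hp => ?_⟩
    · simp only [Algorithm.state, hadj p _ hp]
    · simp only [Algorithm.state, hadj' p _ hp]
  | succ t ih =>
    intro ht p
    have ih' := ih (by omega)
    have hmsg : ∀ q, (q, p) ∈ E → alg.send (alg.state (H x y) ids ω t q) (ids p)
        = alg.send (alg.state (H x' y') ids ω t q) (ids p) := fun q hq =>
      encode_injective (congrFun (congrFun htr ⟨t, by omega⟩) ⟨(q, p), hq⟩)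
    refine ⟨fun hp => ?_, fun hp => ?_⟩
    · simp only [Algorithm.state]
      rw [(ih' p).1 hp]
      congr 1
      ext z
      simp only [Set.mem_ofPred_eq, hadj p _ hp]
      refine exists_congr fun q => and_congr_right fun hpq => ?_
      cases hq : side q with
      | true => rw [(ih' q).1 hq]
      | false =>
        rw [(ih' q).2 hq, hmsg q (hE x y q p hpq.symm (by rw [hp, hq]; decide))]
    · simp only [Algorithm.state]
      rw [(ih' p).2 hp]
      congr 1
      ext z
      simp only [Set.mem_ofPred_eq, hadj' p _ hp]
      refine exists_congr fun q => and_congr_right fun hpq => ?_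
      cases hq : side q with
      | false => rw [(ih' q).2 hq]
      | true =>
        rw [(ih' q).1 hq, hmsg q (hE x' y' q p hpq.symm (by rw [hp, hq]; decide))]

theorem cut_and_paste (hH : IsTwoParty H side)
    (hE : ∀ x y p q, (H x y).Adj p q → side p ≠ side q → (p, q) ∈ E) (ω : Ω) (x : X) (y : Y)
    (x' : X) (y' : Y) (hxy : ¬ alg.AnswersYes R (H x y) ids ω)
    (hxy' : ¬ alg.AnswersYes R (H x' y') ids ω)
    (htr : transcript alg H ids E R ω x y = transcript alg H ids E R ω x' y') :
    ¬ alg.AnswersYes R (H x y') ids ω ∧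
      transcript alg H ids E R ω x y' = transcript alg H ids E R ω x y := by
  have hp := state_paste hH hE htr
  constructor
  · rintro ⟨p, h⟩
    cases hs : side p with
    | true => exact hxy ⟨p, by rwa [← (hp R le_rfl p).1 hs]⟩
    | false => exact hxy' ⟨p, by rwa [← (hp R le_rfl p).2 hs]⟩
  · funext t e
    cases hs : side e.1.1 with
    | true => simp only [transcript, (hp t t.2.le e.1.1).1 hs]
    | false =>
      rw [htr]
      simp only [transcript, (hp t t.2.le e.1.1).2 hs]

/-- The reduction from set disjointness: an algorithm which decides on a two-party family of
networks whether the inputs intersect has to send many bits along the edges between the parties. -/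
theorem exp_le_of_decides {ι : Type*} [Fintype ι] [DecidableEq ι] {m : ℕ}
    (hm : Fintype.card ι + 1 = 2 * m) [MeasurableSpace Ω] (μ : Measure Ω) [IsProbabilityMeasure μ]
    (alg : Algorithm.{u, v} Ω n β B) (hβ : n ≤ 2 ^ β)
    (H : Finset ι → Finset ι → SimpleGraph (Fin n)) (hH : IsTwoParty H side)
    (hE : ∀ x y p q, (H x y).Adj p q → side p ≠ side q → (p, q) ∈ E)
    {𝒢 : Set (SimpleGraph (Fin n))} {P : SimpleGraph (Fin n) → Prop} (h𝒢 : ∀ x y, H x y ∈ 𝒢)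
    (hP : ∀ x y, P (H x y) ↔ ¬ Disjoint x y) (halg : alg.Decides μ R 𝒢 P) :
    Real.exp ((m : ℝ) / 20000) ≤ 60 * 3 ^ (B * E.card * R) := by
  -- One assignment of identifiers serves for all inputs, so that a node's view can depend on the
  -- inputs only through the graph.
  obtain ⟨ids⟩ : Nonempty (Fin n ↪ NodeId β) := by
    rw [Function.Embedding.nonempty_iff_card_le]
    simpa using hβ
  have key := SetDisjointness.exp_le_card_transcripts hm μ
    (fun ω x y => ¬ alg.AnswersYes R (H x y) ids ω) (transcript alg H ids E R)
    (fun ω x y x' y' => cut_and_paste hH hE ω x y x' y') ?_ ?_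
  · refine key.trans (le_of_eq ?_)
    simp only [Fintype.card_fun, Fintype.card_option, Fintype.card_bool, Fintype.card_fin,
      Fintype.card_coe]
    push_cast
    rw [← pow_mul, ← pow_mul]
    norm_num
    ring
  · intro x y hxy
    have h := halg (H x y) (h𝒢 x y) ids
    have e : alg.correctSet R P (H x y) ids = {ω | ¬ alg.AnswersYes R (H x y) ids ω} := by
      ext ω
      simp [Algorithm.correctSet, hP, hxy]
    rwa [e] at h
  · intro x y hxy
    have h := halg (H x y) (h𝒢 x y) ids
    have e : {ω | ¬ alg.AnswersYes R (H x y) ids ω} = (alg.correctSet R P (H x y) ids)ᶜ := by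
      ext ω
      simp [Algorithm.correctSet, hP, hxy]
    refine ⟨e ▸ h.1.compl, ?_⟩
    rw [e, probReal_compl_eq_one_sub h.1]
    linarith [h.2]

end Simulation

/-! ### Induced cycles by positions and by local properties -/

/-- Consecutive positions on a cycle of length `k`. -/
def CyclicallyAdjacent (k p q : ℕ) : Prop :=
  q = p + 1 ∨ p = q + 1 ∨ (p = 0 ∧ q + 1 = k) ∨ (q = 0 ∧ p + 1 = k)

theorem cycleGraph_adj_iff {k : ℕ} (hk : 3 ≤ k) (a b : Fin k) :
    (SimpleGraph.cycleGraph k).Adj a b ↔ CyclicallyAdjacent k a b := by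
  rw [SimpleGraph.cycleGraph_adj', CyclicallyAdjacent]
  have ha := a.2
  have hb := b.2
  rcases lt_trichotomy a b with h | h | h
  · have h1 := Fin.coe_sub_iff_lt.2 h
    have h2 := Fin.sub_val_of_le h.le
    rw [Fin.lt_def] at h
    omega
  · subst h
    have h2 := Fin.sub_val_of_le (le_refl a)
    omega
  · have h1 := Fin.coe_sub_iff_lt.2 h
    have h2 := Fin.sub_val_of_le h.le
    rw [Fin.lt_def] at h
    omega

/-- This turns the existence of a cycle in a gadget into arithmetic with positions. -/
theorem hasInducedCycle_of_positions {V : Type*} {k : ℕ} (hk : 3 ≤ k) (G : SimpleGraph V)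
    (pos : V → ℕ) (good : V → Prop) (hsurj : ∀ p < k, ∃ v, good v ∧ pos v = p)
    (hadj : ∀ v w, good v → good w → (G.Adj v w ↔ CyclicallyAdjacent k (pos v) (pos w))) :
    HasInducedCycle k G := by
  choose f hf hpos using fun p : Fin k => hsurj p p.2
  refine ⟨⟨⟨f, fun p q h => ?_⟩, fun {p q} => ?_⟩⟩
  · apply Fin.ext; rw [← hpos p, ← hpos q, h]
  · rw [cycleGraph_adj_iff hk, ← hpos p, ← hpos q]
    exact hadj _ _ (hf p) (hf q)

/-- The local properties of the vertex set of an induced cycle of length at least five. -/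
structure IsCycleSet {W : Type*} (G : SimpleGraph W) (S : Finset W) : Prop where
  two : ∀ v ∈ S, ∃ a ∈ S, ∃ b ∈ S, a ≠ b ∧ G.Adj v a ∧ G.Adj v b ∧
    ∀ c ∈ S, G.Adj v c → c = a ∨ c = b
  tri : ∀ a ∈ S, ∀ b ∈ S, ∀ c ∈ S, G.Adj a b → G.Adj b c → ¬ G.Adj a c
  quad : ∀ a ∈ S, ∀ b ∈ S, ∀ c ∈ S, ∀ d ∈ S, G.Adj a b → G.Adj b c → G.Adj c d → G.Adj d a →
    a = c ∨ b = d

/-- Connectedness is forgotten: two neighbours at each vertex and no short cycles suffice once every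
block is known to be exhausted. -/
theorem HasInducedCycle.exists_isCycleSet {W : Type*} {G : SimpleGraph W} {k : ℕ} (hk : 5 ≤ k)
    (h : HasInducedCycle k G) : ∃ S : Finset W, S.card = k ∧ IsCycleSet G S := by
  obtain ⟨f⟩ := h
  have hadj : ∀ p q : Fin k, G.Adj (f p) (f q) ↔ CyclicallyAdjacent k p q := fun p q => by
    rw [← cycleGraph_adj_iff (by omega), f.map_adj_iff]
  refine ⟨Finset.univ.map f.toEmbedding, by simp, ⟨?_, ?_, ?_⟩⟩
  · simp only [Finset.mem_map, Finset.mem_univ, true_and]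
    rintro _ ⟨p, rfl⟩
    have hp := p.2
    obtain ⟨a, ha⟩ : ∃ a : Fin k, (a : ℕ) = if (p : ℕ) + 1 = k then 0 else (p : ℕ) + 1 :=
      ⟨⟨if (p : ℕ) + 1 = k then 0 else (p : ℕ) + 1, by split_ifs <;> omega⟩, rfl⟩
    obtain ⟨b, hb⟩ : ∃ b : Fin k, (b : ℕ) = if (p : ℕ) = 0 then k - 1 else (p : ℕ) - 1 :=
      ⟨⟨if (p : ℕ) = 0 then k - 1 else (p : ℕ) - 1, by split_ifs <;> omega⟩, rfl⟩
    refine ⟨f a, ⟨a, rfl⟩, f b, ⟨b, rfl⟩, f.injective.ne ?_, (hadj p a).2 ?_, (hadj p b).2 ?_, ?_⟩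
    · rw [Ne, Fin.ext_iff]; split_ifs at ha hb <;> omega
    · unfold CyclicallyAdjacent; split_ifs at ha <;> omega
    · unfold CyclicallyAdjacent; split_ifs at hb <;> omega
    · rintro _ ⟨c, rfl⟩ hc
      have hc := (hadj p c).1 hc
      have := c.2
      have : c = a ∨ c = b := by
        rw [Fin.ext_iff, Fin.ext_iff]
        unfold CyclicallyAdjacent at hc
        split_ifs at ha hb <;> omega
      rcases this with rfl | rfl
      · exact Or.inl rfl
      · exact Or.inr rfl
  · simp only [Finset.mem_map, Finset.mem_univ, true_and]
    rintro _ ⟨a, rfl⟩ _ ⟨b, rfl⟩ _ ⟨c, rfl⟩ hab hbc hac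
    have h1 := (hadj a b).1 hab
    have h2 := (hadj b c).1 hbc
    have h3 := (hadj a c).1 hac
    unfold CyclicallyAdjacent at *
    omega
  · simp only [Finset.mem_map, Finset.mem_univ, true_and]
    rintro _ ⟨a, rfl⟩ _ ⟨b, rfl⟩ _ ⟨c, rfl⟩ _ ⟨d, rfl⟩ hab hbc hcd hda
    have h1 := (hadj a b).1 hab
    have h2 := (hadj b c).1 hbc
    have h3 := (hadj c d).1 hcd
    have h4 := (hadj d a).1 hda
    have : a = c ∨ b = d := by
      rw [Fin.ext_iff, Fin.ext_iff]
      have := a.2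
      have := b.2
      have := c.2
      have := d.2
      unfold CyclicallyAdjacent at *
      omega
    rcases this with rfl | rfl
    · exact Or.inl rfl
    · exact Or.inr rfl

/-! ### Hubs and pendant vertices: diameter exactly three -/

section Hubs

/-- The vertices of a graph, together with two hubs and `r` further vertices. -/
abbrev HubVertex (V : Type*) (r : ℕ) : Type _ := V ⊕ Bool ⊕ Fin r

variable {V : Type*}

/-- The side on which a vertex lies; the first pendant vertex lies on the side `false`, the other
ones on the side `true`. -/
def hubSide (side : V → Bool) {r : ℕ} : HubVertex V r → Bool
  | Sum.inl v => side v
  | Sum.inr (Sum.inl σ) => σ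
  | Sum.inr (Sum.inr i) => decide ((i : ℕ) ≠ 0)

/-- Adjacency in the graph extended by hubs. -/
def hubAdj (G : SimpleGraph V) (side : V → Bool) {r : ℕ} : HubVertex V r → HubVertex V r → Prop
  | Sum.inl v, Sum.inl w => G.Adj v w
  | Sum.inl v, Sum.inr (Sum.inl σ) => side v = σ
  | Sum.inr (Sum.inl σ), Sum.inl v => side v = σ
  | Sum.inr (Sum.inl σ), Sum.inr (Sum.inl σ') => σ ≠ σ'
  | Sum.inr (Sum.inl σ), Sum.inr (Sum.inr i) => decide ((i : ℕ) ≠ 0) = σ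
  | Sum.inr (Sum.inr i), Sum.inr (Sum.inl σ) => decide ((i : ℕ) ≠ 0) = σ
  | _, _ => False

/-- The extension of a graph by two adjacent hubs, each of them adjacent to all the vertices on its
side, and by pendant vertices. -/
def hubGraph (G : SimpleGraph V) (side : V → Bool) (r : ℕ) : SimpleGraph (HubVertex V r) where
  Adj := hubAdj G side
  symm := ⟨by
    rintro (v | σ | i) (w | σ' | j) h <;> simp only [hubAdj] at h ⊢
    · exact h.symm
    · exact h
    · exact h
    · exact Ne.symm h
    · exact h
    · exact h⟩
  loopless := ⟨by
    rintro (v | σ | i) h <;> simp only [hubAdj] at h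
    · exact G.loopless.irrefl v h
    · exact h rfl⟩

theorem hubGraph_adj_hub (G : SimpleGraph V) (side : V → Bool) {r : ℕ} {w : HubVertex V r}
    {σ : Bool} (hw : hubSide side w = σ) (hne : w ≠ Sum.inr (Sum.inl σ)) :
    (hubGraph G side r).Adj w (Sum.inr (Sum.inl σ)) := by
  rcases w with v | τ | i
  · exact hw
  · exact absurd (congrArg (fun b => Sum.inr (Sum.inl b)) hw) hne
  · exact hw

/-- Every vertex is within distance one of its hub, and the hubs are adjacent. Pendants at different
hubs have no common neighbour; `2 ≤ r` provides such a pair. -/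
theorem hubGraph_ediam (G : SimpleGraph V) (side : V → Bool) {r : ℕ} (hr : 2 ≤ r) :
    (hubGraph G side r).ediam = 3 := by
  set H := hubGraph G side r
  have h1 : ∀ w : HubVertex V r, H.edist w (Sum.inr (Sum.inl (hubSide side w))) ≤ 1 := by
    intro w
    rw [SimpleGraph.edist_le_one_iff_adj_or_eq]
    by_cases h : w = Sum.inr (Sum.inl (hubSide side w))
    · exact Or.inr h
    · exact Or.inl (hubGraph_adj_hub G side rfl h)
  have h2 : ∀ σ τ : Bool, H.edist (Sum.inr (Sum.inl σ)) (Sum.inr (Sum.inl τ)) ≤ 1 := by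
    intro σ τ
    rw [SimpleGraph.edist_le_one_iff_adj_or_eq]
    by_cases h : σ = τ
    · exact Or.inr (by rw [h])
    · exact Or.inl h
  apply le_antisymm
  · rw [SimpleGraph.ediam_le_iff]
    intro w w'
    calc H.edist w w' ≤ H.edist w (Sum.inr (Sum.inl (hubSide side w)))
          + (H.edist (Sum.inr (Sum.inl (hubSide side w))) (Sum.inr (Sum.inl (hubSide side w')))
          + H.edist (Sum.inr (Sum.inl (hubSide side w'))) w') :=
          SimpleGraph.edist_triangle.trans (by gcongr; exact SimpleGraph.edist_triangle)
      _ ≤ 1 + (1 + 1) := by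
          gcongr
          · exact h1 w
          · exact h2 _ _
          · rw [SimpleGraph.edist_comm]; exact h1 w'
      _ = 3 := by norm_num
  · refine le_trans ?_ (SimpleGraph.edist_le_ediam
      (u := (Sum.inr (Sum.inr ⟨0, by omega⟩) : HubVertex V r))
      (v := Sum.inr (Sum.inr ⟨1, by omega⟩)))
    have : (2 : ℕ∞) < H.edist (Sum.inr (Sum.inr ⟨0, by omega⟩) : HubVertex V r)
        (Sum.inr (Sum.inr ⟨1, by omega⟩)) := by
      rw [SimpleGraph.two_lt_edist_iff]
      refine ⟨by simp, id, ?_⟩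
      rw [Set.eq_empty_iff_forall_notMem]
      rintro (v | σ | i) ⟨ha, hb⟩
      · exact ha
      · have ha' : false = σ := ha
        have hb' : true = σ := hb
        simp [← hb'] at ha'
      · exact ha
    exact Order.add_one_le_of_lt this

end Hubs

theorem edist_le_of_hom {V W : Type*} {G : SimpleGraph V} {H : SimpleGraph W} (f : G →g H)
    (a b : V) : H.edist (f a) (f b) ≤ G.edist a b :=
  le_iInf fun p => (SimpleGraph.edist_le (p.map f)).trans (by rw [SimpleGraph.Walk.length_map])

theorem ediam_eq_of_iso {V W : Type*} {G : SimpleGraph V} {H : SimpleGraph W} (f : G ≃g H) :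
    G.ediam = H.ediam := by
  apply le_antisymm <;> rw [SimpleGraph.ediam_le_iff] <;> intro a b
  · have h := edist_le_of_hom f.symm.toHom (f a) (f b)
    simp only [SimpleGraph.Iso.toHom, SimpleGraph.Embedding.toHom] at h
    have h' : G.edist a b ≤ H.edist (f a) (f b) := by simpa using h
    exact h'.trans SimpleGraph.edist_le_ediam
  · have h := edist_le_of_hom f.toHom (f.symm a) (f.symm b)
    have h' : H.edist a b ≤ G.edist (f.symm a) (f.symm b) := by simpa using h
    exact h'.trans SimpleGraph.edist_le_ediam

/-! ### Gadgets and the lower bound they provide -/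

/-- A two-party family of graphs on `V` for the reduction from set disjointness over `ι` to the
detection of induced `k`-cycles. The vertices are covered by cliques, the blocks, each of which
lies on one side, and a `k`-cycle can only fit if it exhausts the capacity of each block. -/
structure CycleGadget (k : ℕ) (ι V κ : Type) [DecidableEq ι] [Fintype κ] [DecidableEq κ] where
  graph : Finset ι → Finset ι → SimpleGraph V
  side : V → Bool
  twoParty : IsTwoParty graph side
  block : V → κ
  blockSide : κ → Bool
  cap : κ → ℕ
  blockSide_block : ∀ v, blockSide (block v) = side v
  cap_eq : ∀ b, cap b = 2 ∨ cap b = 1 ∧ ∀ v w, block v = b → block w = b → v = w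
  clique : ∀ x y v w, v ≠ w → block v = block w → (graph x y).Adj v w
  sum_cap : ∑ b, cap b = k
  -- Needed to exclude hubs: a hub leaves room for at most three cycle vertices on its side, itself
  -- included, which is less than four.
  sum_cap_side : ∀ σ, 4 ≤ ∑ b with blockSide b = σ, cap b
  cut : Finset (V × V)
  mem_cut : ∀ x y v w, (graph x y).Adj v w → side v ≠ side w → (v, w) ∈ cut
  hasInducedCycle : ∀ x y, ¬ Disjoint x y → HasInducedCycle k (graph x y)
  not_disjoint : ∀ x y S, IsCycleSet (graph x y) S → (∀ b, (S.filter (block · = b)).card = cap b) →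
    ¬ Disjoint x y

namespace CycleGadget

variable {k : ℕ} {ι V κ : Type} [DecidableEq ι] [Fintype κ] [DecidableEq κ]
  (g : CycleGadget k ι V κ)

theorem card_block_le {x y : Finset ι} {S : Finset V}
    (htri : ∀ a ∈ S, ∀ b ∈ S, ∀ c ∈ S, (g.graph x y).Adj a b → (g.graph x y).Adj b c →
      ¬ (g.graph x y).Adj a c) (b : κ) :
    (S.filter (g.block · = b)).card ≤ g.cap b := by
  rcases g.cap_eq b with h | ⟨h, h'⟩
  · rw [h]
    by_contra hcon
    push Not at hcon
    obtain ⟨u, hu, v, hv, w, hw, huv, huw, hvw⟩ := Finset.two_lt_card.1 hcon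
    rw [Finset.mem_filter] at hu hv hw
    exact htri u hu.1 v hv.1 w hw.1 (g.clique x y u v huv (hu.2.trans hv.2.symm))
      (g.clique x y v w hvw (hv.2.trans hw.2.symm)) (g.clique x y u w huw (hu.2.trans hw.2.symm))
  · rw [h, Finset.card_le_one]
    intro v hv w hw
    exact h' v w (Finset.mem_filter.1 hv).2 (Finset.mem_filter.1 hw).2

/-- A pendant vertex has degree one, and a hub makes the cycle too short. Hence the cycle lies in
the gadget, and as it has as many vertices as the capacities allow in total, it meets each block in
exactly its capacity. -/
theorem not_disjoint_of_hubGraph [Fintype V] [DecidableEq V] (hk : 8 ≤ k) {r : ℕ} (x y : Finset ι)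
    (h : HasInducedCycle k (hubGraph (g.graph x y) g.side r)) : ¬ Disjoint x y := by
  obtain ⟨S, hS, hC⟩ := h.exists_isCycleSet (by omega)
  set H := hubGraph (g.graph x y) g.side r with hH
  set S₀ : Finset V := Finset.univ.filter fun v => Sum.inl v ∈ S with hS₀
  have mem₀ : ∀ v, v ∈ S₀ ↔ Sum.inl v ∈ S := fun v => by simp [hS₀]
  have hpend : ∀ i : Fin r, Sum.inr (Sum.inr i) ∉ S := by
    intro i hi
    obtain ⟨a, _, b, _, hab, ha, hb, _⟩ := hC.two _ hi
    rcases a with a | a | a <;> rcases b with b | b | b <;>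
      first | exact ha | exact hb | skip
    have ha' : decide ((i : ℕ) ≠ 0) = a := ha
    have hb' : decide ((i : ℕ) ≠ 0) = b := hb
    exact hab (by rw [← ha', ← hb'])
  have htri : ∀ a ∈ S₀, ∀ b ∈ S₀, ∀ c ∈ S₀, (g.graph x y).Adj a b → (g.graph x y).Adj b c →
      ¬ (g.graph x y).Adj a c := by
    intro a ha b hb c hc
    exact hC.tri _ ((mem₀ a).1 ha) _ ((mem₀ b).1 hb) _ ((mem₀ c).1 hc)
  have hside : ∀ σ, Sum.inr (Sum.inl σ) ∈ S → (S.filter (hubSide g.side · = σ)).card ≤ 3 := by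
    intro σ hσ
    obtain ⟨a, _, b, _, _, _, _, hmax⟩ := hC.two _ hσ
    refine (Finset.card_le_card (t := {Sum.inr (Sum.inl σ), a, b}) ?_).trans Finset.card_le_three
    intro w hw
    rw [Finset.mem_filter] at hw
    simp only [Finset.mem_insert, Finset.mem_singleton]
    by_cases hne : w = Sum.inr (Sum.inl σ)
    · exact Or.inl hne
    · exact Or.inr (hmax w hw.1 (hubGraph_adj_hub _ _ hw.2 hne).symm)
  have hsplit : ∀ σ, (S.filter (hubSide g.side · = σ)).card
      + (S.filter (hubSide g.side · = !σ)).card = k := by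
    intro σ
    refine Eq.trans ?_ hS
    rw [← Finset.card_filter_add_card_filter_not (s := S) (hubSide g.side · = σ)]
    congr 2
    ext w
    simp only [Finset.mem_filter]
    cases hubSide g.side w <;> cases σ <;> simp
  have hhub : ∀ σ, Sum.inr (Sum.inl σ) ∉ S := by
    intro σ hσ
    have h1 := hside σ hσ
    have h2 := hsplit σ
    -- With both hubs the cycle has at most `3 + 3 < 8` vertices; with one hub at most `3 + (k -
    -- 4)`.
    by_cases hσ' : Sum.inr (Sum.inl !σ) ∈ S
    · have := hside _ hσ'
      omega
    · have h3 : S.filter (hubSide g.side · = !σ)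
          ⊆ (S₀.filter (g.side · = !σ)).map ⟨Sum.inl, Sum.inl_injective⟩ := by
        rintro (v | τ | i) hw <;> rw [Finset.mem_filter] at hw
        · exact Finset.mem_map_of_mem ⟨Sum.inl, Sum.inl_injective⟩
            (Finset.mem_filter.2 ⟨(mem₀ v).2 hw.1, hw.2⟩)
        · have hτ : τ = !σ := hw.2
          exact absurd (hτ ▸ hw.1) hσ'
        · exact absurd hw.1 (hpend i)
      have h4 := Finset.card_le_card h3
      rw [Finset.card_map] at h4
      have h5 : (S₀.filter (g.side · = !σ)).card
          ≤ ∑ b with g.blockSide b = !σ, g.cap b := by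
        rw [Finset.card_eq_sum_card_fiberwise (f := g.block)
          (t := Finset.univ.filter (g.blockSide · = !σ)) (fun v hv => by
            have := (Finset.mem_filter.1 hv).2
            simp [g.blockSide_block, this])]
        refine Finset.sum_le_sum fun b _ => le_trans (Finset.card_le_card ?_)
          (g.card_block_le htri b)
        exact Finset.filter_subset_filter _ (Finset.filter_subset _ _)
      have h6 := Finset.sum_filter_add_sum_filter_not Finset.univ (g.blockSide · = σ) g.cap
      rw [g.sum_cap] at h6
      have h7 := g.sum_cap_side σ
      have h8 : (Finset.univ.filter fun b => ¬ g.blockSide b = σ)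
          = Finset.univ.filter (g.blockSide · = !σ) := by
        ext b
        simp only [Finset.mem_filter]
        cases g.blockSide b <;> cases σ <;> simp
      rw [h8] at h6
      omega
  have hinl : ∀ w ∈ S, ∃ v ∈ S₀, w = Sum.inl v := by
    rintro (v | σ | i) hw
    · exact ⟨v, (mem₀ v).2 hw, rfl⟩
    · exact absurd hw (hhub σ)
    · exact absurd hw (hpend i)
  have hcard : S₀.card = k := by
    rw [← hS, ← Finset.card_map ⟨Sum.inl, Sum.inl_injective⟩]
    congr 1
    ext w
    simp only [Finset.mem_map, Function.Embedding.coeFn_mk]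
    constructor
    · rintro ⟨v, hv, rfl⟩
      exact (mem₀ v).1 hv
    · intro hw
      obtain ⟨v, hv, rfl⟩ := hinl w hw
      exact ⟨v, hv, rfl⟩
  refine g.not_disjoint x y S₀ ⟨?_, htri, ?_⟩ ?_
  · intro v hv
    obtain ⟨a, ha, b, hb, hab, hva, hvb, hmax⟩ := hC.two _ ((mem₀ v).1 hv)
    obtain ⟨a, ha', rfl⟩ := hinl a ha
    obtain ⟨b, hb', rfl⟩ := hinl b hb
    refine ⟨a, ha', b, hb', fun h => hab (by rw [h]), hva, hvb, fun c hc hvc => ?_⟩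
    rcases hmax _ ((mem₀ c).1 hc) hvc with h | h
    · exact Or.inl (Sum.inl_injective h)
    · exact Or.inr (Sum.inl_injective h)
  · intro a ha b hb c hc d hd hab hbc hcd hda
    rcases hC.quad _ ((mem₀ a).1 ha) _ ((mem₀ b).1 hb) _ ((mem₀ c).1 hc) _ ((mem₀ d).1 hd)
      hab hbc hcd hda with h | h
    · exact Or.inl (Sum.inl_injective h)
    · exact Or.inr (Sum.inl_injective h)
  · have h1 : ∑ b, (S₀.filter (g.block · = b)).card = ∑ b, g.cap b := by
      refine Eq.trans ?_ (hcard.trans g.sum_cap.symm)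
      exact (Finset.card_eq_sum_card_fiberwise fun _ _ => by simp).symm
    have h2 := (Finset.sum_eq_sum_iff_of_le fun b _ => g.card_block_le htri b).1 h1
    exact fun b => h2 b (Finset.mem_univ b)

theorem hasInducedCycle_hubGraph_iff [Fintype V] [DecidableEq V] (hk : 8 ≤ k) {r : ℕ}
    (x y : Finset ι) :
    HasInducedCycle k (hubGraph (g.graph x y) g.side r) ↔ ¬ Disjoint x y := by
  refine ⟨g.not_disjoint_of_hubGraph hk x y, fun h => ?_⟩
  have e : g.graph x y ↪g hubGraph (g.graph x y) g.side r :=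
    ⟨⟨Sum.inl, Sum.inl_injective⟩, Iff.rfl⟩
  exact (g.hasInducedCycle x y h).trans ⟨e⟩

theorem isTwoParty_hubGraph (r : ℕ) :
    IsTwoParty (fun x y => hubGraph (g.graph x y) g.side r) (hubSide g.side) := by
  constructor
  · rintro x y y' (v | σ | i) (w | τ | j) hp h
    · exact g.twoParty.left x y y' v w hp h
    all_goals exact h
  · rintro x x' y (v | σ | i) (w | τ | j) hp h
    · exact g.twoParty.right x x' y v w hp h
    all_goals exact h

/-- The lower bound provided by a gadget with few vertices and a small cut. -/
theorem exp_le [Fintype V] [DecidableEq V] [Fintype ι] (hk : 8 ≤ k) {n : ℕ}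
    (hn : Fintype.card V + 4 ≤ n) {m : ℕ} (hm : Fintype.card ι + 1 = 2 * m)
    {Ω : Type u} [MeasurableSpace Ω] (μ : Measure Ω) [IsProbabilityMeasure μ] {β B R : ℕ}
    (hβ : n ≤ 2 ^ β) (alg : Algorithm.{u, v} Ω n β B)
    (halg : alg.Decides μ R {G | G.ediam = 3} (HasInducedCycle k)) :
    Real.exp ((m : ℝ) / 20000) ≤ 60 * 3 ^ (B * (g.cut.card + 2) * R) := by
  -- Pendant vertices pad the network to exactly `n` nodes.
  obtain ⟨r, hr⟩ : ∃ r, n = Fintype.card V + (2 + r) := ⟨n - Fintype.card V - 2, by omega⟩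
  have e : HubVertex V r ≃ Fin n := Fintype.equivFinOfCardEq (by simp [hr])
  set H : Finset ι → Finset ι → SimpleGraph (Fin n) := fun x y =>
    (hubGraph (g.graph x y) g.side r).comap e.symm with hHdef
  have iso : ∀ x y, H x y ≃g hubGraph (g.graph x y) g.side r := fun x y =>
    SimpleGraph.Iso.comap e.symm _
  set E₀ : Finset (HubVertex V r × HubVertex V r) :=
    g.cut.map ⟨fun z => (Sum.inl z.1, Sum.inl z.2), fun z z' h => by
      simpa [Prod.ext_iff] using h⟩
      ∪ {(Sum.inr (Sum.inl true), Sum.inr (Sum.inl false)),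
        (Sum.inr (Sum.inl false), Sum.inr (Sum.inl true))} with hE₀
  have hE₀card : E₀.card ≤ g.cut.card + 2 := by
    refine (Finset.card_union_le _ _).trans ?_
    rw [Finset.card_map]
    gcongr
    exact Finset.card_le_two
  set E : Finset (Fin n × Fin n) := E₀.map (e.prodCongr e).toEmbedding with hE
  have key := exp_le_of_decides (side := fun p => hubSide g.side (e.symm p)) (E := E) (R := R)
    hm μ alg hβ H ?_ ?_ (𝒢 := {G | G.ediam = 3}) (P := HasInducedCycle k) ?_ ?_ halg
  · refine key.trans ?_
    rw [hE, Finset.card_map]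
    gcongr
    norm_num
  · exact ⟨fun x y y' p q => (g.isTwoParty_hubGraph r).left x y y' _ _,
      fun x x' y p q => (g.isTwoParty_hubGraph r).right x x' y _ _⟩
  · intro x y p q hpq hs
    have hpq' : (hubGraph (g.graph x y) g.side r).Adj (e.symm p) (e.symm q) := hpq
    have : (e.symm p, e.symm q) ∈ E₀ := by
      generalize e.symm p = p' at hpq' hs
      generalize e.symm q = q' at hpq' hs
      rw [hE₀, Finset.mem_union]
      rcases p' with v | σ | i <;> rcases q' with w | τ | j
      · exact Or.inl (Finset.mem_map.2 ⟨(v, w), g.mem_cut x y v w hpq' hs, rfl⟩)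
      · exact absurd hpq' hs
      · exact hpq'.elim
      · exact absurd (Eq.symm hpq') hs
      · right
        have : σ ≠ τ := hpq'
        cases σ <;> cases τ <;> simp at this ⊢
      · exact absurd (Eq.symm hpq') hs
      · exact hpq'.elim
      · exact absurd hpq' hs
      · exact hpq'.elim
    rw [hE, Finset.mem_map]
    exact ⟨_, this, by simp⟩
  · intro x y
    change (H x y).ediam = 3
    rw [ediam_eq_of_iso (iso x y)]
    exact hubGraph_ediam _ _ (by omega)
  · intro x y
    rw [← g.hasInducedCycle_hubGraph_iff hk (r := r) x y]
    exact ⟨fun h => h.trans ⟨(iso x y).toEmbedding⟩, fun h => h.trans ⟨(iso x y).symm.toEmbedding⟩⟩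

end CycleGadget

/-! ### Neighbours and block mates in a cycle set; input relations -/

theorem IsCycleSet.eq_or_eq {W : Type*} {G : SimpleGraph W} {S : Finset W} (h : IsCycleSet G S)
    {v a b c : W} (hv : v ∈ S) (ha : a ∈ S) (hb : b ∈ S) (hc : c ∈ S) (hab : a ≠ b)
    (hva : G.Adj v a) (hvb : G.Adj v b) (hvc : G.Adj v c) : c = a ∨ c = b := by
  obtain ⟨d, _, e, _, _, _, _, hmax⟩ := h.two v hv
  rcases hmax a ha hva with rfl | rfl <;> rcases hmax b hb hvb with rfl | rfl <;>
    rcases hmax c hc hvc with rfl | rfl <;> simp_all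

theorem IsCycleSet.exists_other {W : Type*} {G : SimpleGraph W} {S : Finset W}
    (h : IsCycleSet G S) {v a : W} (hv : v ∈ S) : ∃ b ∈ S, b ≠ a ∧ G.Adj v b := by
  obtain ⟨d, hd, e, he, hde, hvd, hve, _⟩ := h.two v hv
  by_cases hda : d = a
  · exact ⟨e, he, fun h => hde (hda.trans h.symm), hve⟩
  · exact ⟨d, hd, hda, hvd⟩

theorem exists_mate {W κ : Type*} [DecidableEq κ] {S : Finset W} {block : W → κ} {b : κ}
    (h : (S.filter (block · = b)).card = 2) {v : W} (hv : v ∈ S) (hvb : block v = b) :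
    ∃ v' ∈ S, v' ≠ v ∧ block v' = b ∧ ∀ u ∈ S, block u = b → u = v ∨ u = v' := by
  classical
  obtain ⟨p, q, hpq, hS⟩ := Finset.card_eq_two.1 h
  have hmem : ∀ u, (u ∈ S ∧ block u = b) ↔ u = p ∨ u = q := fun u => by
    have := congrArg (u ∈ ·) hS
    simpa using this
  have hp := (hmem p).2 (Or.inl rfl)
  have hq := (hmem q).2 (Or.inr rfl)
  rcases (hmem v).1 ⟨hv, hvb⟩ with rfl | rfl
  · exact ⟨q, hq.1, hpq.symm, hq.2, fun u hu hub => (hmem u).1 ⟨hu, hub⟩⟩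
  · exact ⟨p, hp.1, hpq, hp.2, fun u hu hub => ((hmem u).1 ⟨hu, hub⟩).symm⟩

theorem exists_mem_block {W κ : Type*} [DecidableEq κ] {S : Finset W} {block : W → κ} {b : κ}
    (h : 0 < (S.filter (block · = b)).card) : ∃ v ∈ S, block v = b := by
  obtain ⟨v, hv⟩ := Finset.card_pos.1 h
  exact ⟨v, (Finset.mem_filter.1 hv).1, (Finset.mem_filter.1 hv).2⟩

/-- The input pairs of Alice (`σ = true`) and Bob. -/
def inputRel {ι K : Type} (coord : ι ↪ K × K) (x y : Finset ι) (σ : Bool) (i j : K) : Prop :=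
  ∃ z ∈ if σ then x else y, coord z = (i, j)

theorem not_disjoint_of_inputRel {ι K : Type} {coord : ι ↪ K × K} {x y : Finset ι} {i j : K}
    (h : ∀ σ, inputRel coord x y σ i j) : ¬ Disjoint x y := by
  obtain ⟨z, hz, hzij⟩ := h true
  obtain ⟨z', hz', hzij'⟩ := h false
  obtain rfl := coord.injective (hzij.trans hzij'.symm)
  exact fun hd => Finset.disjoint_left.1 hd hz hz'

theorem exists_inputRel {ι K : Type} {coord : ι ↪ K × K} {x y : Finset ι} (h : ¬ Disjoint x y) :
    ∃ i j, ∀ σ, inputRel coord x y σ i j := by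
  obtain ⟨z, hz, hz'⟩ := Finset.not_disjoint_iff.1 h
  refine ⟨(coord z).1, (coord z).2, fun σ => ⟨z, ?_, rfl⟩⟩
  cases σ
  · exact hz'
  · exact hz

/-! ### The gadget for `ℓ = 1`: observers matched across the cut -/

namespace DirectGadget

/-- For each side and each of the two indices a clique of the observers `some c` and an anchor
`none`; and a path of `q` further vertices. -/
abbrev Vertex (K : Type) (q : ℕ) : Type := (Bool × Bool × Option K) ⊕ Fin q

variable {K : Type} {q : ℕ}

/-- Adjacency for given forbidden pairs of observers. -/
def adj (I : Bool → K → K → Prop) : Vertex K q → Vertex K q → Prop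
  | Sum.inl (σ, w, o), Sum.inl (σ', w', o') =>
    (σ = σ' ∧ w = w' ∧ o ≠ o') ∨
    (σ = σ' ∧ w ≠ w' ∧ ((∃ c c', o = some c ∧ o' = some c' ∧
      ¬ I σ (if w then c' else c) (if w then c else c')) ∨
      (o = none ∧ o' = none ∧ (σ = true ∨ q = 0)))) ∨
    (σ ≠ σ' ∧ w = w' ∧ o = o' ∧ o ≠ none)
  | Sum.inl (σ, w, o), Sum.inr r =>
    σ = false ∧ o = none ∧ if w then (r : ℕ) = 0 else (r : ℕ) + 1 = q
  | Sum.inr r, Sum.inl (σ, w, o) =>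
    σ = false ∧ o = none ∧ if w then (r : ℕ) = 0 else (r : ℕ) + 1 = q
  | Sum.inr r, Sum.inr r' => (r : ℕ) + 1 = r' ∨ (r' : ℕ) + 1 = r

/-- The graph for given forbidden pairs of observers. -/
def graph (I : Bool → K → K → Prop) : SimpleGraph (Vertex K q) where
  Adj := adj I
  symm := ⟨by
    rintro (⟨σ, w, o⟩ | r) (⟨σ', w', o'⟩ | r') h
    · rcases h with ⟨rfl, rfl, h⟩ | ⟨rfl, hw, ⟨c, c', rfl, rfl, h⟩ | ⟨rfl, rfl, h⟩⟩ |
        ⟨hσ, rfl, rfl, h⟩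
      · exact Or.inl ⟨rfl, rfl, h.symm⟩
      · refine Or.inr (Or.inl ⟨rfl, hw.symm, Or.inl ⟨c', c, rfl, rfl, ?_⟩⟩)
        cases w <;> cases w' <;> first | exact absurd rfl hw | exact h
      · exact Or.inr (Or.inl ⟨rfl, hw.symm, Or.inr ⟨rfl, rfl, h⟩⟩)
      · exact Or.inr (Or.inr ⟨hσ.symm, rfl, rfl, h⟩)
    · exact h
    · exact h
    · exact Or.symm h⟩
  loopless := ⟨by
    rintro (⟨σ, w, o⟩ | r) h
    · rcases h with ⟨-, -, h⟩ | ⟨-, h, -⟩ | ⟨h, -⟩ <;> exact h rfl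
    · rcases h with h | h <;> omega⟩

theorem graph_adj (I : Bool → K → K → Prop) (u v : Vertex K q) :
    (graph I).Adj u v = adj I u v := rfl

/-- The vertices which belong to the pair `(i, j)` of indices. -/
def IsAt (i j : K) : Vertex K q → Prop
  | Sum.inl (_, w, o) => ∀ c, o = some c → c = if w then j else i
  | Sum.inr _ => True

/-- Alice's vertices. -/
def side : Vertex K q → Bool
  | Sum.inl (σ, _, _) => σ
  | Sum.inr _ => false

/-- The cliques and the single vertices of the path. -/
def block : Vertex K q → (Bool × Bool) ⊕ Fin q
  | Sum.inl (σ, w, _) => Sum.inl (σ, w)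
  | Sum.inr r => Sum.inr r

/-- The position on an induced cycle. -/
def pos : Vertex K q → ℕ
  | Sum.inl (true, false, some _) => 0
  | Sum.inl (true, false, none) => 1
  | Sum.inl (true, true, none) => 2
  | Sum.inl (true, true, some _) => 3
  | Sum.inl (false, true, some _) => 4
  | Sum.inl (false, true, none) => 5
  | Sum.inr r => 6 + r
  | Sum.inl (false, false, none) => 6 + q
  | Sum.inl (false, false, some _) => 7 + q

theorem hasInducedCycle (I : Bool → K → K → Prop) {i j : K} (h : ∀ σ, I σ i j) :
    HasInducedCycle (8 + q) (graph (q := q) I) := by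
  refine hasInducedCycle_of_positions (by omega) _ pos (IsAt i j) ?_ ?_
  · intro p hp
    have hsome : ∀ σ w, IsAt i j (Sum.inl (σ, w, some (if w then j else i)) : Vertex K q) :=
      fun σ w c hc => (Option.some.inj hc).symm
    have hnone : ∀ σ w, IsAt i j (Sum.inl (σ, w, none) : Vertex K q) :=
      fun σ w c hc => by simp at hc
    by_cases hr : 6 ≤ p ∧ p < 6 + q
    · exact ⟨Sum.inr ⟨p - 6, by omega⟩, trivial, by simp only [pos]; omega⟩
    have hcases : p = 0 ∨ p = 1 ∨ p = 2 ∨ p = 3 ∨ p = 4 ∨ p = 5 ∨ p = 6 + q ∨ p = 7 + q := by omega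
    rcases hcases with rfl | rfl | rfl | rfl | rfl | rfl | rfl | rfl
    · exact ⟨_, hsome true false, rfl⟩
    · exact ⟨_, hnone true false, rfl⟩
    · exact ⟨_, hnone true true, rfl⟩
    · exact ⟨_, hsome true true, rfl⟩
    · exact ⟨_, hsome false true, rfl⟩
    · exact ⟨_, hnone false true, rfl⟩
    · exact ⟨_, hnone false false, rfl⟩
    · exact ⟨_, hsome false false, rfl⟩
  · rintro (⟨σ, w, o⟩ | r) (⟨σ', w', o'⟩ | r') hv hv'
    · rw [graph_adj]
      cases o with
      | none =>
        cases o' with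
        | none =>
          cases σ <;> cases w <;> cases σ' <;> cases w' <;>
            simp [adj, pos, CyclicallyAdjacent] <;> omega
        | some c' =>
          cases σ <;> cases w <;> cases σ' <;> cases w' <;>
            simp [adj, pos, CyclicallyAdjacent] <;> omega
      | some c =>
        obtain rfl := hv c rfl
        cases o' with
        | none =>
          cases σ <;> cases w <;> cases σ' <;> cases w' <;>
            simp [adj, pos, CyclicallyAdjacent] <;> omega
        | some c' =>
          obtain rfl := hv' c' rfl
          cases σ <;> cases w <;> cases σ' <;> cases w' <;>
            simp [adj, pos, CyclicallyAdjacent, h] <;> omega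
    · rw [graph_adj]
      have := r'.2
      cases σ <;> cases w <;> rcases o with _ | c <;> simp [adj, pos, CyclicallyAdjacent] <;> omega
    · rw [graph_adj]
      have := r.2
      cases σ' <;> cases w' <;> rcases o' with _ | c <;>
        simp [adj, pos, CyclicallyAdjacent] <;> omega
    · rw [graph_adj]
      have := r.2
      have := r'.2
      simp only [adj, pos, CyclicallyAdjacent]
      omega

/-- Each of the two indices must use a matching edge across the cut, which gives both sides the same
`i` and `j`. At the observer of `i` this edge and the edge to its clique mate use up the degree, so
it is not adjacent to the observer of `j`. -/
theorem exists_of_isCycleSet (I : Bool → K → K → Prop) {S : Finset (Vertex K q)}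
    (hS : IsCycleSet (graph I) S)
    (hcard : ∀ b : Bool × Bool, (S.filter (block · = Sum.inl b)).card = 2) :
    ∃ i j, ∀ σ, I σ i j := by
  have hclique : ∀ u v : Vertex K q, u ≠ v → ∀ b, block u = Sum.inl b → block v = Sum.inl b →
      (graph I).Adj u v := by
    rintro (⟨σ, w, o⟩ | r) (⟨σ', w', o'⟩ | r') huv b hu hv <;>
      simp only [block, Sum.inl.injEq, reduceCtorEq] at hu hv
    obtain ⟨rfl, rfl⟩ := Prod.mk.inj (hu.trans hv.symm)
    exact Or.inl ⟨rfl, rfl, fun h => huv (by rw [h])⟩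
  have hcross : ∀ w, ∃ c, ∀ σ, Sum.inl (σ, w, some c) ∈ S := by
    intro w
    by_contra hcon
    push Not at hcon
    -- Without a matching edge, both cycle vertices of Alice's clique `w` continue into her clique
    -- `!w`. This closes a triangle if they continue to the same vertex and a quadrilateral
    -- otherwise.
    have hnb : ∀ u ∈ S, block u = Sum.inl (true, w) → ∀ v ∈ S, (graph I).Adj u v →
        block v = Sum.inl (true, w) ∨ block v = Sum.inl (true, !w) := by
      rintro (⟨σ, w₁, o⟩ | r) hu hub (⟨σ', w', o'⟩ | r') hv huv
      · simp only [block, Sum.inl.injEq, Prod.mk.injEq] at hub ⊢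
        obtain ⟨rfl, rfl⟩ := hub
        rcases huv with ⟨rfl, rfl, h⟩ | ⟨rfl, hw, -⟩ | ⟨hσ, rfl, rfl, h⟩
        · simp
        · cases w₁ <;> cases w' <;> simp at hw ⊢
        · obtain ⟨c, rfl⟩ := Option.ne_none_iff_exists'.1 h
          obtain ⟨τ, hτ⟩ := hcon c
          cases τ with
          | true => exact absurd hu hτ
          | false =>
            have : σ' = false := by cases σ' <;> simp at hσ ⊢
            exact absurd (this ▸ hv) hτ
      · simp only [block, Sum.inl.injEq, Prod.mk.injEq] at hub
        have h := huv.1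
        simp [hub.1] at h
      · simp [block] at hub
      · simp [block] at hub
    obtain ⟨u, hu, hub⟩ := exists_mem_block (S := S) (block := block) (b := Sum.inl (true, w))
      (by rw [hcard]; norm_num)
    obtain ⟨v, hv, hvu, hvb, huniq⟩ := exists_mate (hcard (true, w)) hu hub
    have huv := hclique u v hvu.symm _ hub hvb
    obtain ⟨u', hu', hu'v, huu'⟩ := hS.exists_other (a := v) hu
    obtain ⟨v', hv', hv'u, hvv'⟩ := hS.exists_other (a := u) hv
    have hu'b : block u' = Sum.inl (true, !w) := by
      rcases hnb u hu hub u' hu' huu' with h | h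
      · rcases huniq u' hu' h with rfl | rfl
        · exact absurd rfl huu'.ne
        · exact absurd rfl hu'v
      · exact h
    have hv'b : block v' = Sum.inl (true, !w) := by
      rcases hnb v hv hvb v' hv' hvv' with h | h
      · rcases huniq v' hv' h with rfl | rfl
        · exact absurd rfl hv'u
        · exact absurd rfl hvv'.ne
      · exact h
    by_cases h : u' = v'
    · subst h
      exact hS.tri u hu v hv u' hu' huv hvv' huu'
    · rcases hS.quad u hu v hv v' hv' u' hu' huv hvv' (hclique v' u' (Ne.symm h) _ hv'b hu'b)
        huu'.symm with rfl | rfl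
      · rw [hub] at hv'b; cases w <;> simp at hv'b
      · rw [hvb] at hu'b; cases w <;> simp at hu'b
  obtain ⟨i, hi⟩ := hcross false
  obtain ⟨j, hj⟩ := hcross true
  refine ⟨i, j, fun σ => ?_⟩
  by_contra hcon
  obtain ⟨v, hv, hvne, hvb, -⟩ := exists_mate (hcard (σ, false)) (hi σ) rfl
  have hadj1 : (graph I).Adj (Sum.inl (σ, false, some i) : Vertex K q)
      (Sum.inl (!σ, false, some i)) := Or.inr (Or.inr ⟨by simp, rfl, rfl, by simp⟩)
  have hadj2 : (graph I).Adj (Sum.inl (σ, false, some i) : Vertex K q)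
      (Sum.inl (σ, true, some j)) :=
    Or.inr (Or.inl ⟨rfl, by simp, Or.inl ⟨i, j, rfl, rfl, hcon⟩⟩)
  rcases hS.eq_or_eq (hi σ) (hi (!σ)) hv (hj σ)
    (by rintro rfl; simp [block] at hvb) hadj1
    (hclique _ _ hvne.symm _ rfl hvb) hadj2 with h | h
  · simp at h
  · rw [← h] at hvb; simp [block] at hvb

/-- The gadget with a cut of linear size. -/
noncomputable def gadget {ι : Type} [DecidableEq ι] [Fintype K] [DecidableEq K] (q : ℕ)
    (coord : ι ↪ K × K) : CycleGadget (8 + q) ι (Vertex K q) ((Bool × Bool) ⊕ Fin q) where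
  graph x y := graph (inputRel coord x y)
  side := side
  twoParty := by
    constructor
    · rintro x y y' (⟨σ, w, o⟩ | r) (⟨σ', w', o'⟩ | r') hp h
      · change σ = true at hp
        subst hp
        exact h
      all_goals exact h
    · rintro x x' y (⟨σ, w, o⟩ | r) (⟨σ', w', o'⟩ | r') hp h
      · change σ = false at hp
        subst hp
        exact h
      all_goals exact h
  block := block
  blockSide := Sum.elim Prod.fst fun _ => false
  cap := Sum.elim (fun _ => 2) fun _ => 1
  blockSide_block := by rintro (⟨σ, w, o⟩ | r) <;> rfl
  cap_eq := by
    rintro (b | r)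
    · exact Or.inl rfl
    · refine Or.inr ⟨rfl, ?_⟩
      rintro (⟨σ, w, o⟩ | r) (⟨σ', w', o'⟩ | r') h h' <;>
        simp only [block, Sum.inr.injEq, reduceCtorEq] at h h'
      rw [h, h']
  clique := by
    rintro x y (⟨σ, w, o⟩ | r) (⟨σ', w', o'⟩ | r') hne h <;>
      simp only [block, Sum.inl.injEq, Sum.inr.injEq, Prod.mk.injEq, reduceCtorEq] at h
    · obtain ⟨rfl, rfl⟩ := h
      exact Or.inl ⟨rfl, rfl, fun h => hne (by rw [h])⟩
    · exact absurd (by rw [h]) hne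
  sum_cap := by simp [Fintype.sum_sum_type]
  sum_cap_side := by
    intro σ
    have h := Finset.sum_le_sum_of_subset (f := Sum.elim (fun _ => 2) fun _ => 1)
      (s := ({Sum.inl (σ, false), Sum.inl (σ, true)} : Finset ((Bool × Bool) ⊕ Fin q)))
      (t := Finset.univ.filter fun b => Sum.elim Prod.fst (fun _ => false) b = σ) (by
        intro b hb
        simp only [Finset.mem_insert, Finset.mem_singleton] at hb
        rcases hb with rfl | rfl <;> simp)
    rw [Finset.sum_pair (by simp)] at h
    exact h
  cut := Finset.univ.image fun z : Bool × Bool × K =>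
    (Sum.inl (z.1, z.2.1, some z.2.2), Sum.inl (!z.1, z.2.1, some z.2.2))
  mem_cut := by
    rintro x y (⟨σ, w, o⟩ | r) (⟨σ', w', o'⟩ | r') h hs
    · rcases h with ⟨rfl, -⟩ | ⟨rfl, -⟩ | ⟨hσ, rfl, rfl, ho⟩
      · exact absurd rfl hs
      · exact absurd rfl hs
      · obtain ⟨c, rfl⟩ := Option.ne_none_iff_exists'.1 ho
        have : σ' = !σ := by cases σ <;> cases σ' <;> simp at hσ ⊢
        subst this
        exact Finset.mem_image.2 ⟨(σ, w, c), Finset.mem_univ _, rfl⟩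
    · exact absurd h.1 hs
    · exact absurd h.1.symm hs
    · exact absurd rfl hs
  hasInducedCycle := by
    intro x y h
    obtain ⟨i, j, hij⟩ := exists_inputRel (coord := coord) h
    exact hasInducedCycle _ hij
  not_disjoint := by
    intro x y S hS hcard
    obtain ⟨i, j, hij⟩ := exists_of_isCycleSet _ hS fun b => hcard (Sum.inl b)
    exact not_disjoint_of_inputRel hij

theorem card_cut_le {ι : Type} [DecidableEq ι] [Fintype K] [DecidableEq K] (q : ℕ)
    (coord : ι ↪ K × K) : (gadget q coord).cut.card ≤ 4 * Fintype.card K := by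
  refine Finset.card_image_le.trans (le_of_eq ?_)
  simp
  ring

theorem card_vertex [Fintype K] : Fintype.card (Vertex K q) = 4 * Fintype.card K + (4 + q) := by
  simp
  ring

end DirectGadget

/-! ### The gadget for `ℓ ≥ 2`: code words compared level by level -/

namespace LevelGadget

/-- For each side and each of the two indices a clique of the observers `some c` and an anchor
`none`; for each side and each of the `2 * ℓ` levels a clique of `s` vertices; and a path of `q`
further vertices. -/
abbrev Vertex (ℓ s q : ℕ) : Type :=
  (Bool × Bool × Option (Fin ℓ → Fin s)) ⊕ (Bool × Fin (2 * ℓ) × Fin s) ⊕ Fin q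

variable {ℓ s q : ℕ}

/-- The symbol of a code word at a level. -/
def symbol (c : Fin ℓ → Fin s) (t : Fin (2 * ℓ)) : Fin s := c ⟨t / 2, by omega⟩

/-- Odd levels are observed by the second index (`w = true`), even ones by the first index. -/
def isOdd (t : Fin (2 * ℓ)) : Bool := decide ((t : ℕ) % 2 = 1)

/-- The level next to the observers. -/
def home (ℓ : ℕ) (σ w : Bool) : ℕ := if w then 0 else if σ then 1 else 2 * ℓ - 1

/-- The clique of a level. -/
def levelBlock (σ : Bool) (t : Fin (2 * ℓ)) : Fin (ℓ + 1) :=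
  ⟨if σ then (if (t : ℕ) = 0 then ℓ else t / 2) else (t + 1) / 2, by
    have := t.2; split_ifs <;> omega⟩

/-- Adjacency for given forbidden pairs of observers. -/
def adj (I : Bool → (Fin ℓ → Fin s) → (Fin ℓ → Fin s) → Prop) : Vertex ℓ s q → Vertex ℓ s q → Prop
  | Sum.inl (σ, w, o), Sum.inl (σ', w', o') =>
    (σ = σ' ∧ w = w' ∧ o ≠ o') ∨
    (σ = σ' ∧ w ≠ w' ∧ ((∃ c c', o = some c ∧ o' = some c' ∧
      ¬ I σ (if w then c' else c) (if w then c else c')) ∨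
      (o = none ∧ o' = none ∧ (σ = true ∨ q = 0))))
  | Sum.inl (σ, w, o), Sum.inr (Sum.inl (σ', t, d)) =>
    σ = σ' ∧ ∃ c, o = some c ∧ if isOdd t = w then symbol c t ≠ d else (t : ℕ) = home ℓ σ w
  | Sum.inr (Sum.inl (σ', t, d)), Sum.inl (σ, w, o) =>
    σ = σ' ∧ ∃ c, o = some c ∧ if isOdd t = w then symbol c t ≠ d else (t : ℕ) = home ℓ σ w
  | Sum.inr (Sum.inl (σ, t, d)), Sum.inr (Sum.inl (σ', t', d')) =>
    (σ = σ' ∧ levelBlock σ t = levelBlock σ' t' ∧ ¬ (t = t' ∧ d = d')) ∨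
    (σ ≠ σ' ∧ t = t' ∧ d = d')
  | Sum.inl (σ, w, o), Sum.inr (Sum.inr r) =>
    σ = false ∧ o = none ∧ if w then (r : ℕ) + 1 = q else (r : ℕ) = 0
  | Sum.inr (Sum.inr r), Sum.inl (σ, w, o) =>
    σ = false ∧ o = none ∧ if w then (r : ℕ) + 1 = q else (r : ℕ) = 0
  | Sum.inr (Sum.inr r), Sum.inr (Sum.inr r') => (r : ℕ) + 1 = r' ∨ (r' : ℕ) + 1 = r
  | _, _ => False

/-- The graph for given forbidden pairs of observers. -/
def graph (I : Bool → (Fin ℓ → Fin s) → (Fin ℓ → Fin s) → Prop) :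
    SimpleGraph (Vertex ℓ s q) where
  Adj := adj I
  symm := ⟨by
    rintro (⟨σ, w, o⟩ | ⟨σ, t, d⟩ | r) (⟨σ', w', o'⟩ | ⟨σ', t', d'⟩ | r') h
    · rcases h with ⟨rfl, rfl, h⟩ | ⟨rfl, hw, ⟨c, c', rfl, rfl, h⟩ | ⟨rfl, rfl, h⟩⟩
      · exact Or.inl ⟨rfl, rfl, h.symm⟩
      · refine Or.inr ⟨rfl, hw.symm, Or.inl ⟨c', c, rfl, rfl, ?_⟩⟩
        cases w <;> cases w' <;> first | exact absurd rfl hw | exact h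
      · exact Or.inr ⟨rfl, hw.symm, Or.inr ⟨rfl, rfl, h⟩⟩
    · exact h
    · exact h
    · exact h
    · rcases h with ⟨rfl, h, hne⟩ | ⟨hσ, rfl, rfl⟩
      · exact Or.inl ⟨rfl, h.symm, fun h => hne ⟨h.1.symm, h.2.symm⟩⟩
      · exact Or.inr ⟨hσ.symm, rfl, rfl⟩
    · exact h
    · exact h
    · exact h
    · exact Or.symm h⟩
  loopless := ⟨by
    rintro (⟨σ, w, o⟩ | ⟨σ, t, d⟩ | r) h
    · rcases h with ⟨-, -, h⟩ | ⟨-, h, -⟩ <;> exact h rfl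
    · rcases h with ⟨-, -, h⟩ | ⟨h, -⟩
      · exact h ⟨rfl, rfl⟩
      · exact h rfl
    · rcases h with h | h <;> omega⟩

theorem graph_adj (I : Bool → (Fin ℓ → Fin s) → (Fin ℓ → Fin s) → Prop) (u v : Vertex ℓ s q) :
    (graph I).Adj u v = adj I u v := rfl

/-- The vertices which belong to the pair `(i, j)` of indices. -/
def IsAt (i j : Fin ℓ → Fin s) : Vertex ℓ s q → Prop
  | Sum.inl (_, w, o) => ∀ c, o = some c → c = if w then j else i
  | Sum.inr (Sum.inl (_, t, d)) => d = symbol (if isOdd t then j else i) t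
  | Sum.inr (Sum.inr _) => True

/-- Alice's vertices. -/
def side : Vertex ℓ s q → Bool
  | Sum.inl (σ, _, _) => σ
  | Sum.inr (Sum.inl (σ, _, _)) => σ
  | Sum.inr (Sum.inr _) => false

/-- The names of the cliques with two vertices on a cycle, of the anchors, and of the vertices of
the path. -/
abbrev BlockName (ℓ q : ℕ) : Type := (Bool × Fin (ℓ + 1)) ⊕ (Bool × Bool) ⊕ Fin q

/-- The block of a vertex. -/
def block : Vertex ℓ s q → BlockName ℓ q
  | Sum.inl (σ, w, some _) => Sum.inl (σ, if σ = w then Fin.last ℓ else 0)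
  | Sum.inl (σ, w, none) => Sum.inr (Sum.inl (σ, w))
  | Sum.inr (Sum.inl (σ, t, _)) => Sum.inl (σ, levelBlock σ t)
  | Sum.inr (Sum.inr r) => Sum.inr (Sum.inr r)

/-- The position on an induced cycle. -/
def pos : Vertex ℓ s q → ℕ
  | Sum.inr (Sum.inl (true, t, _)) =>
    if (t : ℕ) = 0 then 4 * ℓ + q + 3 else 2 * (t - 1) + (t + 1) % 2
  | Sum.inr (Sum.inl (false, t, _)) =>
    if (t : ℕ) = 0 then 4 * ℓ + q + 2 else 2 * (t - 1) + t % 2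
  | Sum.inl (false, false, some _) => 4 * ℓ - 2
  | Sum.inl (false, false, none) => 4 * ℓ - 1
  | Sum.inr (Sum.inr r) => 4 * ℓ + r
  | Sum.inl (false, true, none) => 4 * ℓ + q
  | Sum.inl (false, true, some _) => 4 * ℓ + q + 1
  | Sum.inl (true, true, some _) => 4 * ℓ + q + 4
  | Sum.inl (true, true, none) => 4 * ℓ + q + 5
  | Sum.inl (true, false, none) => 4 * ℓ + q + 6
  | Sum.inl (true, false, some _) => 4 * ℓ + q + 7

theorem exists_isAt_pos (hℓ : 2 ≤ ℓ) (i j : Fin ℓ → Fin s) {p : ℕ} (hp : p < 4 * ℓ + 8 + q) :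
    ∃ v : Vertex ℓ s q, IsAt i j v ∧ pos v = p := by
  have hsome : ∀ σ w, IsAt i j (Sum.inl (σ, w, some (if w then j else i)) : Vertex ℓ s q) :=
    fun σ w c hc => (Option.some.inj hc).symm
  have hnone : ∀ σ w, IsAt i j (Sum.inl (σ, w, none) : Vertex ℓ s q) :=
    fun σ w c hc => by simp at hc
  have hlev : ∀ σ t, IsAt i j (Sum.inr (Sum.inl
    (σ, t, symbol (if isOdd t then j else i) t)) : Vertex ℓ s q) := fun σ t => rfl
  by_cases h1 : p < 4 * ℓ - 2
  · have ht : p / 2 + 1 < 2 * ℓ := by omega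
    -- Alice's cliques join the levels `2 * a` and `2 * a + 1` for `a ≥ 1`, Bob's the levels `2 * a
    -- - 1` and `2 * a`. So the path through the levels follows the pattern Alice, Bob, Bob, Alice
    -- with period four.
    by_cases h2 : p % 4 = 0 ∨ p % 4 = 3
    · refine ⟨_, hlev true ⟨p / 2 + 1, ht⟩, ?_⟩
      simp only [pos]
      rw [if_neg (by omega)]
      omega
    · refine ⟨_, hlev false ⟨p / 2 + 1, ht⟩, ?_⟩
      simp only [pos]
      rw [if_neg (by omega)]
      omega
  by_cases h2 : 4 * ℓ ≤ p ∧ p < 4 * ℓ + q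
  · exact ⟨Sum.inr (Sum.inr ⟨p - 4 * ℓ, by omega⟩), trivial, by simp only [pos]; omega⟩
  have hcases : p = 4 * ℓ - 2 ∨ p = 4 * ℓ - 1 ∨ p = 4 * ℓ + q ∨ p = 4 * ℓ + q + 1 ∨
    p = 4 * ℓ + q + 2 ∨ p = 4 * ℓ + q + 3 ∨ p = 4 * ℓ + q + 4 ∨ p = 4 * ℓ + q + 5 ∨
    p = 4 * ℓ + q + 6 ∨ p = 4 * ℓ + q + 7 := by omega
  rcases hcases with rfl | rfl | rfl | rfl | rfl | rfl | rfl | rfl | rfl | rfl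
  · exact ⟨_, hsome false false, rfl⟩
  · exact ⟨_, hnone false false, rfl⟩
  · exact ⟨_, hnone false true, rfl⟩
  · exact ⟨_, hsome false true, rfl⟩
  · exact ⟨_, hlev false ⟨0, by omega⟩, rfl⟩
  · exact ⟨_, hlev true ⟨0, by omega⟩, rfl⟩
  · exact ⟨_, hsome true true, rfl⟩
  · exact ⟨_, hnone true true, rfl⟩
  · exact ⟨_, hnone true false, rfl⟩
  · exact ⟨_, hsome true false, rfl⟩

theorem adj_observer_level_iff (hℓ : 2 ≤ ℓ) {I : Bool → (Fin ℓ → Fin s) → (Fin ℓ → Fin s) → Prop}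
    {i j : Fin ℓ → Fin s} {z : Bool × Bool × Option (Fin ℓ → Fin s)}
    {z' : Bool × Fin (2 * ℓ) × Fin s} (hz : IsAt i j (Sum.inl z : Vertex ℓ s q))
    (hz' : IsAt i j (Sum.inr (Sum.inl z') : Vertex ℓ s q)) :
    adj I (Sum.inl z : Vertex ℓ s q) (Sum.inr (Sum.inl z')) ↔
      CyclicallyAdjacent (4 * ℓ + 8 + q) (pos (Sum.inl z : Vertex ℓ s q))
        (pos (Sum.inr (Sum.inl z') : Vertex ℓ s q)) := by
  obtain ⟨σ, w, o⟩ := z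
  obtain ⟨σ', t, d⟩ := z'
  have ht := t.2
  have hd : d = symbol (if isOdd t then j else i) t := hz'
  subst hd
  have hodd : isOdd t = true ↔ (t : ℕ) % 2 = 1 := by simp [isOdd]
  cases ho : isOdd t <;> rw [ho] at hodd <;> simp at hodd <;> rcases o with _ | c
  · cases σ <;> cases w <;> cases σ' <;> simp [adj, pos, CyclicallyAdjacent] <;>
      split_ifs <;> omega
  · obtain rfl := hz c rfl
    cases σ <;> cases w <;> cases σ' <;>
      simp [adj, pos, CyclicallyAdjacent, home, ho] <;> split_ifs <;> first | omega | simp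
  · cases σ <;> cases w <;> cases σ' <;> simp [adj, pos, CyclicallyAdjacent] <;>
      split_ifs <;> omega
  · obtain rfl := hz c rfl
    cases σ <;> cases w <;> cases σ' <;>
      simp [adj, pos, CyclicallyAdjacent, home, ho] <;> split_ifs <;> omega

theorem cyclicallyAdjacent_iff_of_lt {k p p' : ℕ} (hp : p + 1 < k) (hp' : p' + 1 < k) :
    CyclicallyAdjacent k p p' ↔ p' = p + 1 ∨ p = p' + 1 := by
  unfold CyclicallyAdjacent
  omega

theorem adj_level_level_iff {I : Bool → (Fin ℓ → Fin s) → (Fin ℓ → Fin s) → Prop}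
    {i j : Fin ℓ → Fin s} {z z' : Bool × Fin (2 * ℓ) × Fin s}
    (hz : IsAt i j (Sum.inr (Sum.inl z) : Vertex ℓ s q))
    (hz' : IsAt i j (Sum.inr (Sum.inl z') : Vertex ℓ s q)) :
    adj I (Sum.inr (Sum.inl z) : Vertex ℓ s q) (Sum.inr (Sum.inl z')) ↔
      CyclicallyAdjacent (4 * ℓ + 8 + q) (pos (Sum.inr (Sum.inl z) : Vertex ℓ s q))
        (pos (Sum.inr (Sum.inl z') : Vertex ℓ s q)) := by
  obtain ⟨σ, t, d⟩ := z
  obtain ⟨σ', t', d'⟩ := z'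
  have ht := t.2
  have ht' := t'.2
  have hd : d = symbol (if isOdd t then j else i) t := hz
  have hd' : d' = symbol (if isOdd t' then j else i) t' := hz'
  have htd : (t = t' ∧ d = d') ↔ (t : ℕ) = t' := by
    rw [← Fin.ext_iff]
    constructor
    · exact fun h => h.1
    · rintro rfl
      exact ⟨rfl, hd.trans hd'.symm⟩
  have hlt : ∀ σ t d, pos (Sum.inr (Sum.inl (σ, t, d)) : Vertex ℓ s q) + 1 < 4 * ℓ + 8 + q := by
    intro σ t d
    have := t.2
    cases σ <;> simp only [pos] <;> split_ifs <;> omega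
  rw [cyclicallyAdjacent_iff_of_lt (hlt _ _ _) (hlt _ _ _)]
  simp only [adj, Fin.ext_iff (n := 2 * ℓ)]
  have hdd : (t : ℕ) = t' ∧ d = d' ↔ (t : ℕ) = t' := by rw [← htd, Fin.ext_iff]; tauto
  rw [hdd]
  by_cases h0 : (t : ℕ) = 0
  · cases σ <;> cases σ' <;>
      simp [pos, levelBlock, Fin.ext_iff, h0] <;> (try split_ifs) <;> omega
  by_cases h0' : (t' : ℕ) = 0
  · cases σ <;> cases σ' <;>
      simp [pos, levelBlock, Fin.ext_iff, h0, h0'] <;> omega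
  -- Writing the level as `2 * a + b` makes blocks and positions linear; the shifts by one and two
  -- avoid truncated subtraction.
  have hA : ∀ t : Fin (2 * ℓ), (t : ℕ) ≠ 0 → ∀ d, ∃ a b, b < 2 ∧ (t : ℕ) = 2 * a + b ∧
      (levelBlock true t : ℕ) = a ∧ (levelBlock false t : ℕ) = a + b ∧
      pos (Sum.inr (Sum.inl (true, t, d)) : Vertex ℓ s q) + 1 = 4 * a + b ∧
      pos (Sum.inr (Sum.inl (false, t, d)) : Vertex ℓ s q) + 2 = 4 * a + 3 * b := by
    intro t ht d
    refine ⟨t / 2, t % 2, Nat.mod_lt _ two_pos, (Nat.div_add_mod _ 2).symm, ?_, ?_, ?_, ?_⟩ <;>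
      simp [levelBlock, pos, ht] <;> omega
  obtain ⟨a, b, hb, hab, h1, h2, h3, h4⟩ := hA t h0 d
  obtain ⟨a', b', hb', hab', h1', h2', h3', h4'⟩ := hA t' h0' d'
  cases σ <;> cases σ' <;> simp only [Fin.ext_iff, h1, h2, h1', h2', hab, hab', reduceCtorEq,
    ne_eq, not_true_eq_false, not_false_eq_true, true_and, false_and, false_or, or_false] <;>
    constructor <;> intro h <;> omega

theorem hasInducedCycle (hℓ : 2 ≤ ℓ) (I : Bool → (Fin ℓ → Fin s) → (Fin ℓ → Fin s) → Prop)
    {i j : Fin ℓ → Fin s} (h : ∀ σ, I σ i j) :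
    HasInducedCycle (4 * ℓ + 8 + q) (graph (q := q) I) := by
  have hsymm : ∀ k p p', CyclicallyAdjacent k p p' ↔ CyclicallyAdjacent k p' p := by
    intro k p p'
    unfold CyclicallyAdjacent
    omega
  refine hasInducedCycle_of_positions (by omega) _ pos (IsAt i j)
    (fun p hp => exists_isAt_pos hℓ i j hp) ?_
  rintro (⟨σ, w, o⟩ | ⟨σ, t, d⟩ | r) (⟨σ', w', o'⟩ | ⟨σ', t', d'⟩ | r') hv hv'
  · rw [graph_adj]
    cases o with
    | none =>
      cases o' with
      | none =>
        cases σ <;> cases w <;> cases σ' <;> cases w' <;>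
          simp [adj, pos, CyclicallyAdjacent] <;> omega
      | some c' =>
        cases σ <;> cases w <;> cases σ' <;> cases w' <;>
          simp [adj, pos, CyclicallyAdjacent] <;> omega
    | some c =>
      obtain rfl := hv c rfl
      cases o' with
      | none =>
        cases σ <;> cases w <;> cases σ' <;> cases w' <;>
          simp [adj, pos, CyclicallyAdjacent] <;> omega
      | some c' =>
        obtain rfl := hv' c' rfl
        cases σ <;> cases w <;> cases σ' <;> cases w' <;>
          simp [adj, pos, CyclicallyAdjacent, h] <;> omega
  · exact adj_observer_level_iff (I := I) hℓ hv hv'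
  · rw [graph_adj]
    have := r'.2
    cases σ <;> cases w <;> rcases o with _ | c <;> simp [adj, pos, CyclicallyAdjacent] <;> omega
  · rw [SimpleGraph.adj_comm, hsymm]
    exact adj_observer_level_iff (I := I) hℓ hv' hv
  · exact adj_level_level_iff (I := I) hv hv'
  · rw [graph_adj]
    have := t.2
    have := r'.2
    cases σ <;> simp only [adj, pos, CyclicallyAdjacent, false_iff] <;> split_ifs <;> omega
  · rw [graph_adj]
    have := r.2
    cases σ' <;> cases w' <;> rcases o' with _ | c <;>
      simp [adj, pos, CyclicallyAdjacent] <;> omega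
  · rw [graph_adj]
    have := t'.2
    have := r.2
    cases σ' <;> simp only [adj, pos, CyclicallyAdjacent, false_iff] <;> split_ifs <;> omega
  · rw [graph_adj]
    have := r.2
    have := r'.2
    simp only [adj, pos, CyclicallyAdjacent]
    omega

/-- The home level has the parity that the observers do not watch, so they can be joined to all of
it and form one clique with it. -/
theorem isOdd_ne_of_eq_home (hℓ : 2 ≤ ℓ) {σ w : Bool} {t : Fin (2 * ℓ)}
    (ht : (t : ℕ) = home ℓ σ w) : isOdd t ≠ w := by
  cases σ <;> cases w <;> simp [isOdd, ht, home]
  omega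

theorem eq_home_iff (hℓ : 2 ≤ ℓ) {σ w : Bool} {t : Fin (2 * ℓ)} :
    (t : ℕ) = home ℓ σ w ↔ levelBlock σ t = if σ = w then Fin.last ℓ else 0 := by
  have := t.2
  cases σ <;> cases w <;> simp [levelBlock, home, Fin.ext_iff] <;> (try split_ifs) <;> omega

theorem clique (hℓ : 2 ≤ ℓ) (I : Bool → (Fin ℓ → Fin s) → (Fin ℓ → Fin s) → Prop)
    {u v : Vertex ℓ s q} (hne : u ≠ v) (h : block u = block v) : (graph I).Adj u v := by
  have hobs : ∀ σ w c σ' t d, block (Sum.inl (σ, w, some c) : Vertex ℓ s q)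
      = block (Sum.inr (Sum.inl (σ', t, d)) : Vertex ℓ s q) →
      (graph I).Adj (Sum.inl (σ, w, some c) : Vertex ℓ s q) (Sum.inr (Sum.inl (σ', t, d))) := by
    intro σ w c σ' t d h
    simp only [block, Sum.inl.injEq, Prod.mk.injEq] at h
    obtain ⟨rfl, h⟩ := h
    have ht := (eq_home_iff hℓ).2 h.symm
    refine ⟨rfl, c, rfl, ?_⟩
    rw [if_neg (isOdd_ne_of_eq_home hℓ ht)]
    exact ht
  rcases u with ⟨σ, w, _ | c⟩ | ⟨σ, t, d⟩ | r <;> rcases v with ⟨σ', w', _ | c'⟩ | ⟨σ', t', d'⟩ | r'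
  any_goals (simp only [block, reduceCtorEq, Sum.inr.injEq] at h; done)
  · simp only [block, Sum.inr.injEq, Sum.inl.injEq, Prod.mk.injEq] at h
    exact absurd (by rw [h.1, h.2]) hne
  · simp only [block, Sum.inl.injEq, Prod.mk.injEq] at h
    obtain ⟨rfl, h⟩ := h
    have hw : w = w' := by
      cases σ <;> cases w <;> cases w' <;> simp [Fin.ext_iff] at h ⊢ <;> omega
    exact Or.inl ⟨rfl, hw, fun h => hne (by rw [hw, h])⟩
  · exact hobs _ _ _ _ _ _ h
  · exact (hobs _ _ _ _ _ _ h.symm).symm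
  · simp only [block, Sum.inl.injEq, Prod.mk.injEq] at h
    obtain ⟨rfl, h⟩ := h
    exact Or.inl ⟨rfl, h, fun h => hne (by rw [h.1, h.2])⟩
  · simp only [block, Sum.inr.injEq] at h
    exact absurd (by rw [h]) hne

variable {I : Bool → (Fin ℓ → Fin s) → (Fin ℓ → Fin s) → Prop} {S : Finset (Vertex ℓ s q)}

/-- A cycle set which exhausts all the blocks contains exactly one observer of each kind. -/
theorem exists_observer (hS : IsCycleSet (graph I) S)
    (hcard : ∀ b, (S.filter (block · = Sum.inr b)).card = 1) (σ w : Bool) :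
    Sum.inl (σ, w, none) ∈ S ∧ ∃ c, Sum.inl (σ, w, some c) ∈ S ∧
      ∀ c', Sum.inl (σ, w, some c') ∈ S → c' = c := by
  have hanchor : ∀ w, Sum.inl (σ, w, none) ∈ S := by
    intro w
    obtain ⟨v, hv, hb⟩ := exists_mem_block (S := S) (block := block)
      (b := Sum.inr (Sum.inl (σ, w))) (by rw [hcard]; norm_num)
    rcases v with ⟨σ', w', _ | c⟩ | ⟨σ', t, d⟩ | r <;>
      simp only [block, Sum.inr.injEq, Sum.inl.injEq, Prod.mk.injEq, reduceCtorEq] at hb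
    rwa [hb.1, hb.2] at hv
  have hpath : ∀ r, Sum.inr (Sum.inr r) ∈ S := by
    intro r
    obtain ⟨v, hv, hb⟩ := exists_mem_block (S := S) (block := block)
      (b := Sum.inr (Sum.inr r)) (by rw [hcard]; norm_num)
    rcases v with ⟨σ', w', _ | c⟩ | ⟨σ', t, d⟩ | r' <;>
      simp only [block, Sum.inr.injEq, reduceCtorEq] at hb
    rwa [hb] at hv
  -- The only neighbour of the anchor outside its observers is the other anchor or an end of the
  -- path, and it lies in `S`. Degree two then leaves exactly one observer.
  obtain ⟨a, ha, haS, hadj, hother⟩ : ∃ a : Vertex ℓ s q, (∀ c, a ≠ Sum.inl (σ, w, some c)) ∧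
      a ∈ S ∧ (graph I).Adj (Sum.inl (σ, w, none)) a ∧
      ∀ b, (graph I).Adj (Sum.inl (σ, w, none)) b → b = a ∨ ∃ c, b = Sum.inl (σ, w, some c) := by
    by_cases hσ : σ = true ∨ q = 0
    · refine ⟨Sum.inl (σ, !w, none), by simp, hanchor _,
        Or.inr ⟨rfl, by simp, Or.inr ⟨rfl, rfl, hσ⟩⟩, ?_⟩
      rintro (⟨σ', w', o⟩ | ⟨σ', t, d⟩ | r) hb
      · rcases hb with ⟨rfl, rfl, h⟩ | ⟨rfl, hw, ⟨c, c', h, -⟩ | ⟨-, rfl, -⟩⟩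
        · obtain ⟨c, rfl⟩ := Option.ne_none_iff_exists'.1 h.symm
          exact Or.inr ⟨c, rfl⟩
        · simp at h
        · left
          cases w <;> cases w' <;> simp at hw ⊢
      · obtain ⟨-, c, h, -⟩ := hb
        simp at h
      · rcases hσ with h | h
        · exact absurd (hb.1.symm.trans h) (by simp)
        · have := r.2
          omega
    · push Not at hσ
      have hσ' : σ = false := by simpa using hσ.1
      refine ⟨Sum.inr (Sum.inr ⟨if w then q - 1 else 0, by split_ifs <;> omega⟩), by simp,
        hpath _, ⟨hσ', rfl, ?_⟩, ?_⟩
      · split_ifs <;> simp; omega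
      rintro (⟨σ', w', o⟩ | ⟨σ', t, d⟩ | r) hb
      · rcases hb with ⟨rfl, rfl, h⟩ | ⟨rfl, hw, ⟨c, c', h, -⟩ | ⟨-, rfl, h | h⟩⟩
        · obtain ⟨c, rfl⟩ := Option.ne_none_iff_exists'.1 h.symm
          exact Or.inr ⟨c, rfl⟩
        · simp at h
        · exact absurd h hσ.1
        · exact absurd h hσ.2
      · obtain ⟨-, c, h, -⟩ := hb
        simp at h
      · left
        have hr := hb.2.2
        congr 2
        rw [Fin.ext_iff]
        cases w <;> simp at hr ⊢ <;> omega
  obtain ⟨b, hbS, hba, hb⟩ := hS.exists_other (a := a) (hanchor w)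
  rcases hother b hb with rfl | ⟨c, rfl⟩
  · exact absurd rfl hba
  refine ⟨hanchor w, c, hbS, fun c' hc' => ?_⟩
  by_contra hne
  rcases hS.eq_or_eq (hanchor w) haS hbS hc' (ha c) hadj hb
    (Or.inl ⟨rfl, rfl, by simp⟩) with h | h
  · exact ha c' h.symm
  · simp only [Sum.inl.injEq, Prod.mk.injEq, Option.some.injEq, true_and] at h
    exact hne h

/-- The degree of each observer is used up by its anchor and one vertex of its home level. Any other
adjacency in `S` is thus excluded: level vertices must agree with the words watching them, and the
two observers of a side must be nonadjacent. -/
theorem exists_of_isCycleSet (hℓ : 2 ≤ ℓ) (hS : IsCycleSet (graph I) S)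
    (hcard : ∀ b, (S.filter (block · = Sum.inl b)).card = 2)
    (hcard' : ∀ b, (S.filter (block · = Sum.inr b)).card = 1) : ∃ i j, ∀ σ, I σ i j := by
  have hobs := exists_observer hS hcard'
  choose hanchor c hc huniq using hobs
  have hhome : ∀ σ w, ∃ (t : Fin (2 * ℓ)) (d : Fin s), (t : ℕ) = home ℓ σ w ∧ Sum.inr (Sum.inl (σ, t, d)) ∈ S ∧
      ∀ v ∈ S, (graph I).Adj (Sum.inl (σ, w, some (c σ w))) v →
        v = Sum.inl (σ, w, none) ∨ v = Sum.inr (Sum.inl (σ, t, d)) := by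
    intro σ w
    obtain ⟨v, hv, hne, hb, -⟩ := exists_mate (hcard (σ, if σ = w then Fin.last ℓ else 0))
      (hc σ w) rfl
    have hadj := clique hℓ I hne (hb.trans rfl : block v = block (Sum.inl (σ, w, some (c σ w))))
    rcases v with ⟨σ', w', _ | c'⟩ | ⟨σ', t, d⟩ | r <;>
      simp only [block, Sum.inl.injEq, Prod.mk.injEq, reduceCtorEq] at hb
    · obtain ⟨rfl, hb⟩ := hb
      have hw : w' = w := by
        cases σ' <;> cases w <;> cases w' <;> simp [Fin.ext_iff] at hb ⊢ <;> omega
      subst hw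
      rw [huniq _ _ _ hv] at hne
      exact absurd rfl hne
    · obtain ⟨rfl, hb⟩ := hb
      exact ⟨t, d, (eq_home_iff hℓ).2 hb, hv, fun u hu huv =>
        hS.eq_or_eq (hc σ' w) (hanchor σ' w) hv hu (by simp) (Or.inl ⟨rfl, rfl, by simp⟩)
          hadj.symm huv⟩
  choose t d hthome htS hmax using hhome
  have hsym : ∀ σ τ e, Sum.inr (Sum.inl (σ, τ, e)) ∈ S → e = symbol (c σ (isOdd τ)) τ := by
    intro σ τ e hS'
    by_contra hne
    have hadj : (graph I).Adj (Sum.inl (σ, isOdd τ, some (c σ (isOdd τ))) : Vertex ℓ s q)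
        (Sum.inr (Sum.inl (σ, τ, e))) :=
      ⟨rfl, _, rfl, by rw [if_pos rfl]; exact Ne.symm hne⟩
    rcases hmax σ (isOdd τ) _ hS' hadj with h | h
    · simp at h
    · simp only [Sum.inr.injEq, Sum.inl.injEq, Prod.mk.injEq, true_and] at h
      have h1 := hthome σ (isOdd τ)
      rw [← h.1] at h1
      exact isOdd_ne_of_eq_home hℓ h1 rfl
  -- Outside the home levels a clique of Alice consists of two levels. By `hsym` each contributes at
  -- most one vertex, so both are present.
  have hpresent : ∀ τ : Fin (2 * ℓ), ∃ e, Sum.inr (Sum.inl (true, τ, e)) ∈ S := by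
    intro τ
    have hτ := τ.2
    by_cases h0 : ∃ w, (τ : ℕ) = home ℓ true w
    · obtain ⟨w, hw⟩ := h0
      obtain rfl : t true w = τ := Fin.ext ((hthome true w).trans hw.symm)
      exact ⟨_, htS true w⟩
    · have hb : ∀ v : Vertex ℓ s q, block v = Sum.inl (true, levelBlock true τ) →
          ∃ τ' e, v = Sum.inr (Sum.inl (true, τ', e)) ∧ levelBlock true τ' = levelBlock true τ := by
        rintro (⟨σ', w', _ | c'⟩ | ⟨σ', t, d⟩ | r) hb <;>
          simp only [block, Sum.inl.injEq, Prod.mk.injEq, reduceCtorEq] at hb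
        · obtain ⟨rfl, hb⟩ := hb
          exact absurd ⟨w', (eq_home_iff hℓ).2 hb.symm⟩ h0
        · obtain ⟨rfl, hb⟩ := hb
          exact ⟨t, d, rfl, hb⟩
      obtain ⟨u, hu, hub⟩ := exists_mem_block (S := S) (block := block)
        (b := Sum.inl (true, levelBlock true τ)) (by rw [hcard]; norm_num)
      obtain ⟨v, hv, hvu, hvb, -⟩ := exists_mate (hcard _) hu hub
      obtain ⟨τ₁, e₁, rfl, h₁⟩ := hb u hub
      obtain ⟨τ₂, e₂, rfl, h₂⟩ := hb v hvb
      have hne : (τ₂ : ℕ) ≠ τ₁ := by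
        intro h
        obtain rfl := Fin.ext h
        rw [hsym _ _ _ hu, hsym _ _ _ hv] at hvu
        exact hvu rfl
      have : τ₁ = τ ∨ τ₂ = τ := by
        push Not at h0
        have h3 := h0 true
        have h4 := h0 false
        simp only [home, levelBlock, Fin.ext_iff, if_true] at h₁ h₂ h3 h4 ⊢
        rw [if_neg h3] at h₁ h₂
        split_ifs at h₁ h₂ <;> omega
      rcases this with rfl | rfl
      · exact ⟨_, hu⟩
      · exact ⟨_, hv⟩
  -- One cycle neighbour is the block mate. The other lies outside the block and cannot be an
  -- observer, so it is the copy across the cut.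
  have hmatch : ∀ τ e, Sum.inr (Sum.inl (true, τ, e)) ∈ S →
      Sum.inr (Sum.inl (false, τ, e)) ∈ S := by
    intro τ e hu
    obtain ⟨v, hv, hne, hvb, hpair⟩ := exists_mate (hcard (true, levelBlock true τ)) hu rfl
    obtain ⟨b, hbS, hbv, hb⟩ := hS.exists_other (a := v) hu
    have hout : block b ≠ Sum.inl (true, levelBlock true τ) := by
      intro h
      rcases hpair b hbS h with rfl | rfl
      · exact hb.ne rfl
      · exact hbv rfl
    rcases b with ⟨σ', w', o⟩ | ⟨σ', t', d'⟩ | r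
    · obtain ⟨rfl, c', rfl, -⟩ := id hb
      obtain rfl := huniq _ _ _ hbS
      exfalso
      rcases hmax _ _ _ hu hb.symm with h | h
      · simp at h
      · simp only [Sum.inr.injEq, Sum.inl.injEq, Prod.mk.injEq, true_and] at h
        have h1 := hthome true w'
        rw [← h.1, eq_home_iff hℓ] at h1
        exact hout (by simp only [block, h1])
    · rcases hb with ⟨rfl, h, -⟩ | ⟨hσ, rfl, rfl⟩
      · exact absurd (by simp only [block, h]) hout
      · have : σ' = false := by cases σ' <;> simp at hσ ⊢
        rwa [this] at hbS
    · exact hb.elim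
  -- Position `x` of the word `w` is read off at level `2 * x` or `2 * x + 1`, where both sides
  -- carry the same vertex.
  have heq : ∀ w, c true w = c false w := by
    intro w
    funext x
    obtain ⟨τ, hτ, hτx⟩ : ∃ τ : Fin (2 * ℓ), isOdd τ = w ∧ ∀ c : Fin ℓ → Fin s,
        symbol c τ = c x := by
      have := x.2
      refine ⟨⟨2 * x + if w then 1 else 0, by split_ifs <;> omega⟩, ?_, fun c => ?_⟩
      · cases w <;> simp [isOdd]
      · simp only [symbol]
        congr 1
        rw [Fin.ext_iff]
        simp only
        split_ifs <;> omega
    obtain ⟨e, he⟩ := hpresent τ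
    have h1 := hsym _ _ _ he
    have h2 := hsym _ _ _ (hmatch τ e he)
    rw [hτ, hτx] at h1 h2
    exact h1.symm.trans h2
  refine ⟨c true false, c true true, fun σ => ?_⟩
  have hI : I σ (c σ false) (c σ true) := by
    by_contra hcon
    have hadj : (graph I).Adj (Sum.inl (σ, false, some (c σ false)) : Vertex ℓ s q)
        (Sum.inl (σ, true, some (c σ true))) :=
      Or.inr ⟨rfl, by simp, Or.inl ⟨_, _, rfl, rfl, hcon⟩⟩
    rcases hmax _ _ _ (hc σ true) hadj with h | h <;> simp at h
  cases σ
  · rwa [heq, heq]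
  · exact hI

/-- The gadget with a cut of size `O(s)`, for `s ^ ℓ` observers of each kind. -/
noncomputable def gadget {ι : Type} [DecidableEq ι] (hℓ : 2 ≤ ℓ) (s q : ℕ)
    (coord : ι ↪ (Fin ℓ → Fin s) × (Fin ℓ → Fin s)) :
    CycleGadget (4 * ℓ + 8 + q) ι (Vertex ℓ s q) (BlockName ℓ q) where
  graph x y := graph (inputRel coord x y)
  side := side
  twoParty := by
    constructor
    · rintro x y y' (⟨σ, w, o⟩ | ⟨σ, t, d⟩ | r) (⟨σ', w', o'⟩ | ⟨σ', t', d'⟩ | r') hp h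
      · change σ = true at hp
        subst hp
        exact h
      all_goals exact h
    · rintro x x' y (⟨σ, w, o⟩ | ⟨σ, t, d⟩ | r) (⟨σ', w', o'⟩ | ⟨σ', t', d'⟩ | r') hp h
      · change σ = false at hp
        subst hp
        exact h
      all_goals exact h
  block := block
  blockSide := Sum.elim Prod.fst (Sum.elim Prod.fst fun _ => false)
  cap := Sum.elim (fun _ => 2) fun _ => 1
  blockSide_block := by rintro (⟨σ, w, _ | c⟩ | ⟨σ, t, d⟩ | r) <;> rfl
  cap_eq := by
    rintro (b | b | b)
    · exact Or.inl rfl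
    all_goals
      refine Or.inr ⟨rfl, ?_⟩
      rintro (⟨σ, w, _ | c⟩ | ⟨σ, t, d⟩ | r) (⟨σ', w', _ | c'⟩ | ⟨σ', t', d'⟩ | r') h h' <;>
        simp only [block, Sum.inr.injEq, Sum.inl.injEq, reduceCtorEq] at h h'
    · obtain ⟨rfl, rfl⟩ := Prod.mk.inj (h.trans h'.symm)
      rfl
    · rw [h, h']
  clique x y v w hne h := clique hℓ _ hne h
  sum_cap := by
    simp [Fintype.sum_sum_type]
    ring
  sum_cap_side := by
    intro σ
    have h := Finset.sum_le_sum_of_subset (f := Sum.elim (fun _ => 2) fun _ => 1)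
      (s := ({Sum.inl (σ, 0), Sum.inl (σ, Fin.last ℓ)} : Finset (BlockName ℓ q)))
      (t := Finset.univ.filter fun b =>
        Sum.elim Prod.fst (Sum.elim Prod.fst fun _ => false) b = σ) (by
        intro b hb
        simp only [Finset.mem_insert, Finset.mem_singleton] at hb
        rcases hb with rfl | rfl <;> simp)
    rw [Finset.sum_pair (by simp [Fin.ext_iff]; omega)] at h
    exact h
  cut := Finset.univ.map ⟨fun z : Bool × Fin (2 * ℓ) × Fin s =>
    (Sum.inr (Sum.inl z), Sum.inr (Sum.inl (!z.1, z.2))), fun z z' h => by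
      simp only [Prod.mk.injEq, Sum.inr.injEq, Sum.inl.injEq] at h
      exact h.1⟩
  mem_cut := by
    rintro x y (⟨σ, w, o⟩ | ⟨σ, t, d⟩ | r) (⟨σ', w', o'⟩ | ⟨σ', t', d'⟩ | r') h hs
    · rcases h with ⟨rfl, -⟩ | ⟨rfl, -⟩ <;> exact absurd rfl hs
    · exact absurd h.1 hs
    · exact absurd h.1 hs
    · exact absurd h.1.symm hs
    · rcases h with ⟨rfl, -⟩ | ⟨hσ, rfl, rfl⟩
      · exact absurd rfl hs
      · have : σ' = !σ := by cases σ <;> cases σ' <;> simp at hσ ⊢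
        subst this
        exact Finset.mem_map.2 ⟨(σ, t, d), Finset.mem_univ _, rfl⟩
    · exact h.elim
    · exact absurd h.1.symm hs
    · exact h.elim
    · exact absurd rfl hs
  hasInducedCycle := by
    intro x y h
    obtain ⟨i, j, hij⟩ := exists_inputRel (coord := coord) h
    exact hasInducedCycle hℓ _ hij
  not_disjoint := by
    intro x y S hS hcard
    obtain ⟨i, j, hij⟩ := exists_of_isCycleSet hℓ hS (fun b => hcard (Sum.inl b))
      fun b => hcard (Sum.inr b)
    exact not_disjoint_of_inputRel hij

theorem card_cut {ι : Type} [DecidableEq ι] (hℓ : 2 ≤ ℓ) (s q : ℕ)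
    (coord : ι ↪ (Fin ℓ → Fin s) × (Fin ℓ → Fin s)) :
    (gadget hℓ s q coord).cut.card = 4 * ℓ * s := by
  rw [gadget, Finset.card_map]
  simp
  ring

theorem card_vertex : Fintype.card (Vertex ℓ s q) = 4 * s ^ ℓ + 4 * ℓ * s + (4 + q) := by
  simp
  ring

end LevelGadget

/-! ### Choice of the parameters -/

/-- The lower bound in terms of the size `s` of the alphabet for the code words of length `ℓ`. -/
theorem exp_le_of_decides_inducedCycle {ℓ m s n : ℕ} (hℓ : 1 ≤ ℓ) (hs : 1 ≤ s)
    (hn : (4 + 4 * ℓ) * s ^ ℓ + (8 * ℓ + m + 8) ≤ n)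
    {Ω : Type u} [MeasurableSpace Ω] (μ : Measure Ω) [IsProbabilityMeasure μ] {β B R : ℕ}
    (hβ : n ≤ 2 ^ β) (alg : Algorithm.{u, v} Ω n β B)
    (halg : alg.Decides μ R {G | G.ediam = 3} (HasInducedCycle (8 * ℓ + m))) :
    Real.exp ((((s ^ (2 * ℓ) + 1) / 2 : ℕ) : ℝ) / 20000) ≤ 60 * 3 ^ (B * (4 * ℓ * s + 2) * R) := by
  classical
  set M := (s ^ (2 * ℓ) + 1) / 2 with hM
  have hs2 : 1 ≤ s ^ (2 * ℓ) := Nat.one_le_pow _ _ hs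
  -- The disjointness bound needs a universe of odd size; `2 * M - 1` is the largest odd number up
  -- to `s ^ (2 * ℓ)`.
  obtain ⟨coord⟩ : Nonempty (Fin (2 * M - 1) ↪ (Fin ℓ → Fin s) × (Fin ℓ → Fin s)) := by
    rw [Function.Embedding.nonempty_iff_card_le]
    simp only [Fintype.card_fin, Fintype.card_prod, Fintype.card_fun]
    rw [← pow_add, ← two_mul]
    omega
  have hcard : Fintype.card (Fin (2 * M - 1)) + 1 = 2 * M := by
    rw [Fintype.card_fin]
    omega
  rcases hℓ.eq_or_lt with rfl | hℓ
  · have h8 : 8 * 1 + m = 8 + m := by ring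
    rw [h8] at halg
    refine ((DirectGadget.gadget m coord).exp_le (by omega) (n := n) ?_ hcard μ hβ alg halg).trans
      ?_
    · rw [DirectGadget.card_vertex]
      simp at hn ⊢
      omega
    · have h := DirectGadget.card_cut_le m coord
      simp only [Fintype.card_fun, Fintype.card_fin, pow_one] at h
      gcongr
      · norm_num
  · obtain ⟨q, hq⟩ : ∃ q, 8 * ℓ + m = 4 * ℓ + 8 + q := ⟨4 * ℓ + m - 8, by omega⟩
    rw [hq] at halg
    refine ((LevelGadget.gadget hℓ s q coord).exp_le (by omega) (n := n) ?_ hcard μ hβ alg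
      halg).trans ?_
    · rw [LevelGadget.card_vertex]
      have h1 : s ≤ s ^ ℓ := Nat.le_self_pow (by omega) s
      have h2 : 4 * ℓ * s ≤ 4 * ℓ * s ^ ℓ := Nat.mul_le_mul_left _ h1
      rw [add_mul] at hn
      omega
    · rw [LevelGadget.card_cut]

/-- Take `s` as the integer part of `(n / a) ^ (1 / ℓ)`; as this root is at least one, rounding
costs a factor of at most two. -/
theorem exists_alphabet_size {ℓ n : ℕ} {a : ℝ} (hℓ : 1 ≤ ℓ) (ha : 1 ≤ a) (hn : a ≤ n) :
    ∃ s : ℕ, 1 ≤ s ∧ a * (s : ℝ) ^ ℓ ≤ n ∧ n ≤ a * (2 * (s : ℝ)) ^ ℓ ∧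
      (n : ℝ) ^ (2 - 1 / (ℓ : ℝ)) ≤ a ^ 2 * (2 * (s : ℝ)) ^ (2 * ℓ - 1) := by
  have hℓ0 : (ℓ : ℝ) ≠ 0 := by positivity
  have ha0 : 0 < a := by linarith
  set z : ℝ := ((n : ℝ) / a) ^ (1 / (ℓ : ℝ)) with hz
  have hna : 1 ≤ (n : ℝ) / a := (one_le_div ha0).2 hn
  have hz1 : 1 ≤ z := Real.one_le_rpow hna (by positivity)
  have hz0 : 0 ≤ z := by linarith
  have hzℓ : z ^ ℓ = n / a := by
    rw [hz, ← Real.rpow_natCast, ← Real.rpow_mul (by positivity), one_div_mul_cancel hℓ0,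
      Real.rpow_one]
  have hs1 : 1 ≤ ⌊z⌋₊ := by rwa [Nat.one_le_floor_iff]
  have hle : (⌊z⌋₊ : ℝ) ≤ z := Nat.floor_le hz0
  have hge : z ≤ 2 * (⌊z⌋₊ : ℝ) := by
    have h1 := Nat.lt_floor_add_one z
    have h2 : (1 : ℝ) ≤ ⌊z⌋₊ := by exact_mod_cast hs1
    linarith
  have hnz : (n : ℝ) = a * z ^ ℓ := by rw [hzℓ]; field_simp
  refine ⟨⌊z⌋₊, hs1, ?_, ?_, ?_⟩
  · rw [hnz]; gcongr
  · rw [hnz]; gcongr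
  · have he : (0 : ℝ) ≤ 1 / (ℓ : ℝ) := by positivity
    have h1 : (z ^ ℓ) ^ (2 - 1 / (ℓ : ℝ)) = z ^ (2 * ℓ - 1) := by
      rw [← Real.rpow_natCast, ← Real.rpow_natCast, ← Real.rpow_mul hz0]
      congr 1
      rw [Nat.cast_sub (by omega)]
      push_cast
      field_simp
    rw [hnz, Real.mul_rpow ha0.le (by positivity), h1]
    have h2 : a ^ (2 - 1 / (ℓ : ℝ)) ≤ a ^ 2 := by
      rw [← Real.rpow_two]
      exact Real.rpow_le_rpow_of_exponent_le ha (by linarith)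
    gcongr

end Congest

theorem theorem2 (k ℓ m : ℕ) (hℓ : 1 ≤ ℓ) (hm : m ≤ 7) (hk : k = 8 * ℓ + m)
    (C : ℝ) (hC : 0 < C) :
    ∃ δ : ℝ, 0 < δ ∧ ∃ n₀ : ℕ, ∀ n : ℕ, n₀ ≤ n →
      ∀ β B R : ℕ, n ≤ 2 ^ β → (B : ℝ) ≤ C * Real.log n →
        ∀ (Ω : Type u) [MeasurableSpace Ω] (μ : MeasureTheory.Measure Ω)
          [MeasureTheory.IsProbabilityMeasure μ] (alg : Congest.Algorithm.{u, v} Ω n β B),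
          alg.Decides μ R {G | G.ediam = 3} (Congest.HasInducedCycle k) →
            δ * ((n : ℝ) ^ (2 - 1 / (ℓ : ℝ)) / Real.log n) ≤ (R : ℝ) := by
  subst hk
  -- Twice the coefficient of `s ^ ℓ` in the size of the network, which keeps half of `n` for the
  -- additive constant.
  set a : ℝ := 8 * ℓ + 8 with ha
  have hℓ1 : (1 : ℝ) ≤ ℓ := by exact_mod_cast hℓ
  have ha1 : 1 ≤ a := by linarith
  refine ⟨1 / (a ^ 2 * 2 ^ (2 * ℓ - 1) * (960000 * ℓ * C)), by positivity,
    5000000 * (8 * ℓ + 8) * 2 ^ ℓ + 2 * (8 * ℓ + m + 8), ?_⟩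
  intro n hn β B R hβ hB Ω _ μ _ alg halg
  have hnR : 5000000 * a * 2 ^ ℓ + 2 * (8 * ℓ + m + 8) ≤ (n : ℝ) := by
    rw [ha]; exact_mod_cast hn
  have hp2 : (1 : ℝ) ≤ 2 ^ ℓ := one_le_pow₀ (by norm_num)
  have hap : a ≤ a * 2 ^ ℓ := le_mul_of_one_le_right (by linarith) hp2
  have hm0 : (0 : ℝ) ≤ m := Nat.cast_nonneg m
  obtain ⟨s, hs, hs1, hs2, hs3⟩ := Congest.exists_alphabet_size (n := n) hℓ ha1 (by linarith)
  have hsR : (1 : ℝ) ≤ s := by exact_mod_cast hs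
  have hsize : (4 + 4 * ℓ) * s ^ ℓ + (8 * ℓ + m + 8) ≤ n := by
    have : ((4 + 4 * ℓ) * s ^ ℓ + (8 * ℓ + m + 8) : ℝ) ≤ n := by
      have h1 : (4 + 4 * ℓ : ℝ) * s ^ ℓ = a * s ^ ℓ / 2 := by rw [ha]; ring
      have h2 : 0 ≤ a * 2 ^ ℓ := by positivity
      rw [h1]
      linarith
    exact_mod_cast this
  have hbig : (5000000 : ℝ) ≤ s ^ (2 * ℓ) := by
    have h1 : 5000000 * (a * 2 ^ ℓ) ≤ (s : ℝ) ^ ℓ * (a * 2 ^ ℓ) := by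
      rw [mul_pow] at hs2
      linarith
    have h2 : (5000000 : ℝ) ≤ (s : ℝ) ^ ℓ := le_of_mul_le_mul_right h1 (by positivity)
    exact h2.trans (pow_le_pow_right₀ hsR (by omega))
  have key := Congest.exp_le_of_decides_inducedCycle hℓ hs hsize μ hβ alg halg
  have hlog := Real.log_le_log (Real.exp_pos _) key
  rw [Real.log_exp, Real.log_mul (by norm_num) (by positivity), Real.log_pow] at hlog
  have h60 : Real.log 60 ≤ 59 := (Real.log_le_sub_one_of_pos (by norm_num)).trans (by norm_num)
  have h3 : Real.log 3 ≤ 2 := (Real.log_le_sub_one_of_pos (by norm_num)).trans (by norm_num)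
  have hM : (s : ℝ) ^ (2 * ℓ) / 2 ≤ (((s ^ (2 * ℓ) + 1) / 2 : ℕ) : ℝ) := by
    have h1 : s ^ (2 * ℓ) ≤ 2 * ((s ^ (2 * ℓ) + 1) / 2) := by omega
    have h2 : ((s ^ (2 * ℓ) : ℕ) : ℝ) ≤ ((2 * ((s ^ (2 * ℓ) + 1) / 2) : ℕ) : ℝ) :=
      Nat.cast_le.2 h1
    rw [Nat.cast_mul, Nat.cast_pow, Nat.cast_two] at h2
    linarith
  have hn3 : (3 : ℝ) ≤ n := by nlinarith
  have hlogn : 0 < Real.log n := Real.log_pos (by linarith)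
  have hE : ((B * (4 * ℓ * s + 2) * R : ℕ) : ℝ) ≤ C * Real.log n * (6 * ℓ * s) * R := by
    push_cast
    have h1 : (4 * ℓ * s + 2 : ℝ) ≤ 6 * ℓ * s := by nlinarith
    gcongr
  have hE2 : ((B * (4 * ℓ * s + 2) * R : ℕ) : ℝ) * Real.log 3
      ≤ C * Real.log n * (6 * ℓ * s) * R * 2 := by
    gcongr
  -- The constant `59` from `log 60`, multiplied by `40000`, is less than half of `5000000` and is
  -- absorbed by the left side; this doubles `40000 * 2 * 6 = 480000`.
  have hmain : (s : ℝ) ^ (2 * ℓ) ≤ 960000 * ℓ * C * Real.log n * R * s := by linarith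
  have hpow : (s : ℝ) ^ (2 * ℓ) = s ^ (2 * ℓ - 1) * s := by
    rw [← pow_succ, Nat.sub_add_cancel (by omega)]
  rw [hpow] at hmain
  have hmain' := le_of_mul_le_mul_right hmain (by linarith)
  rw [one_div, ← div_eq_inv_mul, div_div, div_le_iff₀ (by positivity)]
  calc (n : ℝ) ^ (2 - 1 / (ℓ : ℝ)) ≤ a ^ 2 * (2 ^ (2 * ℓ - 1) * s ^ (2 * ℓ - 1)) := by
        rw [← mul_pow]; exact hs3
    _ ≤ a ^ 2 * (2 ^ (2 * ℓ - 1) * (960000 * ℓ * C * Real.log n * R)) := by gcongr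
    _ = _ := by ring
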